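/- **Theorem (Law of large numbers for $|X_\ell|$).** Let $d\ge 1$, let $|\cdot|$ be the Euclidean norm on $\mathbb{R}^d$, and let $\mu$ be a probability measure on the space $M_d(\mathbb{R})$ of real $d\times d$ matrices satisfying one of the following two conditions. 1. The matrix entries are independent under $\mu$, and for $1\le i,j\le d$ the distribution of the $(i,j)$-entry has a density $p_{ij}$ such that - $\sup_{u\in\mathbb{R}}|p_{ij}(u)|<\infty$; - $\int_{-\infty}^{\infty}u^2p_{ij}(u)\,du<\infty$; - there is $\varepsilon>0$ such that $\inf_{|u|\le\varepsilon}p_{ij}(\delta_{ij}+u)>0$ for all $i,j$, where $\delta_{ij}$ is the Kronecker delta. 2. There is $\eta>0$ such that $\mu$ has a density $p$ with respect to the Haar probability measure $m_{\eta\cdot \mathrm{O}(d)}$ on $\eta\cdot\mathrm{O}(d)=\{\eta Q: Q\in\mathrm{O}(d)\}$ (the image of the Haar probability measure on the orthogonal group $\mathrm{O}(d)$ under $Q\mapsto\eta Q$), and there is $\varepsilon>0$ such that $$\inf_{\substack{Q\in \mathrm{O}(d)\\ \|Q-\mathrm{Id}\|\le\varepsilon}}p(\eta Q)>0 .$$ Let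 $\alpha\in\mathbb{R}\setminus\{0\}$ and let $\phi(x)=\max(x,\alpha x)$ be the Leaky ReLU function, applied to vectors componentwise. If $d=1$, assume in addition that $\alpha<0$, or $\alpha=1$, or $\mu(\{W: W<0\})>0$. Let $W_1,W_2,\dots$ be the coordinates of $\omega\in\Omega=M_d(\mathbb{R})^{\mathbb{N}}$, where $\Omega$ carries the product $\sigma$-algebra and the product measure $\mathbb{P}_\mu=\mu^{\mathbb{N}}$. For $x_0\in\mathbb{R}^d$ put $X_0=x_0$ and $X_\ell=\phi(W_\ell X_{\ell-1})$ for $\ell\ge1$. Then there is a real number $\lambda_{\mu,\phi}$, depending only on $\mu$ and $\phi$, such that for every $x_0\in\mathbb{R}^d\setminus\{0\}$ and for $\mathbb{P}_\mu$-almost every $\omega\in\Omega$ one has $X_\ell(\omega)\neq0$ for all $\ell\ge 0$ and $$\lim_{\ell\to\infty}\frac1\ell\log|X_\ell(\omega)|=\lambda_{\mu,\phi}.$$ Moreover, $$\lim_{\ell\to\infty}\ \sup_{x_0\in\mathbb{R}^d\setminus\{0\}}\mathbb{E}_{\omega\sim\mathbb{P}_\mu}\left[\left|\frac1\ell\log\frac{|X_\ell(\omega)|}{|x_0|}-\lambda_{\mu,\phi}\right|\right]=0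 .$$ -/

import Mathlib

open MeasureTheory ProbabilityTheory Filter Topology Matrix
open scoped ENNReal

noncomputable section

namespace LeakyReLUNet

/-- `M_d(ℝ)` carries the product sigma-algebra of the entries; by the next instance this is its
Borel sigma-algebra. -/
instance matrixMeasurableSpace (d : ℕ) : MeasurableSpace (Matrix (Fin d) (Fin d) ℝ) :=
  inferInstanceAs (MeasurableSpace (Fin d → Fin d → ℝ))

instance matrixBorelSpace (d : ℕ) : BorelSpace (Matrix (Fin d) (Fin d) ℝ) :=
  inferInstanceAs (BorelSpace (Fin d → Fin d → ℝ))

/-- The orthogonal group `O(d)` is compact (needed to normalize its Haar measure). -/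
instance orthogonalCompactSpace (d : ℕ) :
    CompactSpace (Matrix.orthogonalGroup (Fin d) ℝ) := by
  have hK : IsCompact {M : Fin d → Fin d → ℝ | ∀ i j, M i j ∈ Set.Icc (-1 : ℝ) 1} := by
    have h := isCompact_univ_pi (X := fun _ : Fin d => Fin d → ℝ)
      (s := fun _ => Set.univ.pi fun _ : Fin d => Set.Icc (-1 : ℝ) 1)
      (fun _ => isCompact_univ_pi fun _ => isCompact_Icc)
    convert h using 1
    ext M
    simp only [Set.mem_ofPred_eq, Set.mem_pi, Set.mem_univ, true_imp_iff]
  have hc : IsClosed ((Matrix.orthogonalGroup (Fin d) ℝ :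
      Submonoid (Matrix (Fin d) (Fin d) ℝ)) : Set (Matrix (Fin d) (Fin d) ℝ)) :=
    isClosed_unitary
  have hsub : ((Matrix.orthogonalGroup (Fin d) ℝ :
      Submonoid (Matrix (Fin d) (Fin d) ℝ)) : Set (Matrix (Fin d) (Fin d) ℝ)) ⊆
      {M | ∀ i j, M i j ∈ Set.Icc (-1 : ℝ) 1} := by
    intro Q hQ i j
    have h := entry_norm_bound_of_unitary (𝕜 := ℝ) hQ i j
    rw [Real.norm_eq_abs] at h
    exact abs_le.mp h
  exact isCompact_iff_compactSpace.mp (IsCompact.of_isClosed_subset hK hc hsub)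

/-- The Haar probability measure `m_{O(d)}` on the orthogonal group
(normalized so that the whole group has mass `1`). -/
def haarOrthogonal (d : ℕ) : Measure (Matrix.orthogonalGroup (Fin d) ℝ) :=
  Measure.haarMeasure ⊤

/-- The Haar probability measure `m_{η·O(d)}` on `η·O(d) = {ηQ : Q ∈ O(d)}`, regarded as a measure
on `M_d(ℝ)`: the image of `m_{O(d)}` under `Q ↦ ηQ`. -/
def haarScaledOrthogonal (d : ℕ) (η : ℝ) : Measure (Matrix (Fin d) (Fin d) ℝ) :=
  (haarOrthogonal d).map fun Q : Matrix.orthogonalGroup (Fin d) ℝ =>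
    η • (Q : Matrix (Fin d) (Fin d) ℝ)

/-- The operator norm of a matrix for the Euclidean norm on `ℝ^d`. -/
def opNorm {d : ℕ} (M : Matrix (Fin d) (Fin d) ℝ) : ℝ :=
  ‖Matrix.toEuclideanCLM (n := Fin d) (𝕜 := ℝ) M‖

/-- The entries are independent, and the `(i,j)` entry has a bounded density `p i j` with finite
second moment; the densities are bounded below by positive constants on
`[δ_ij - ε, δ_ij + ε]` for a common `ε > 0`. -/
structure HasIndependentEntryDensities {d : ℕ} (μ : Measure (Matrix (Fin d) (Fin d) ℝ))
    (p : Fin d → Fin d → ℝ → ℝ) : Prop where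
  indep : iIndepFun (fun (ij : Fin d × Fin d) (W : Matrix (Fin d) (Fin d) ℝ) => W ij.1 ij.2) μ
  measurable : ∀ i j, Measurable (p i j)
  nonneg : ∀ i j u, 0 ≤ p i j u
  density : ∀ i j, μ.map (fun W => W i j) = volume.withDensity fun u => ENNReal.ofReal (p i j u)
  bounded : ∀ i j, ∃ M : ℝ, ∀ u, |p i j u| ≤ M
  secondMoment : ∀ i j, Integrable fun u => u ^ 2 * p i j u
  locallyPositive : ∃ ε > 0, ∀ i j, ∃ c > 0, ∀ u : ℝ, |u| ≤ ε →
    c ≤ p i j ((1 : Matrix (Fin d) (Fin d) ℝ) i j + u)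

/-- `μ` has a density `p` with respect to `m_{η·O(d)}`, `η > 0`, and `p(ηQ)` is bounded below by a
positive constant for all `Q ∈ O(d)` in a neighbourhood of the identity.
(Only the values of `p` on `η·O(d)` matter.) -/
structure HasScaledOrthogonalDensity {d : ℕ} (μ : Measure (Matrix (Fin d) (Fin d) ℝ))
    (η : ℝ) (p : Matrix (Fin d) (Fin d) ℝ → ℝ) : Prop where
  scale_pos : 0 < η
  measurable : Measurable p
  nonneg : ∀ W, 0 ≤ p W
  density : μ = (haarScaledOrthogonal d η).withDensity fun W => ENNReal.ofReal (p W)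
  locallyPositive : ∃ ε > 0, ∃ c > 0, ∀ Q ∈ Matrix.orthogonalGroup (Fin d) ℝ,
    opNorm (Q - 1) ≤ ε → c ≤ p (η • Q)

/-- The Leaky ReLU activation function. -/
def leakyReLU (α x : ℝ) : ℝ := max x (α * x)

/-- One layer `x ↦ φ(W x)`, with `φ` applied componentwise. -/
def layer {d : ℕ} (α : ℝ) (W : Matrix (Fin d) (Fin d) ℝ) (x : EuclideanSpace ℝ (Fin d)) :
    EuclideanSpace ℝ (Fin d) :=
  WithLp.toLp 2 fun i => leakyReLU α ((W *ᵥ x.ofLp) i)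

/-- The activations `X_ℓ`: `X_0 = x₀` and `X_ℓ = φ(W_ℓ X_{ℓ-1})`.  The weight matrix `W_ℓ`
(`ℓ ≥ 1`) is the coordinate `ω (ℓ - 1)` of `ω : ℕ → M_d(ℝ)`. -/
def activation {d : ℕ} (α : ℝ) (x₀ : EuclideanSpace ℝ (Fin d))
    (ω : ℕ → Matrix (Fin d) (Fin d) ℝ) : ℕ → EuclideanSpace ℝ (Fin d)
  | 0 => x₀
  | ℓ + 1 => layer α (ω ℓ) (activation α x₀ ω ℓ)

end LeakyReLUNet

end

/-!
The layers are positively homogeneous, so `Y_ℓ = X_ℓ / |X_ℓ|` is a Markov chain on the unit sphere,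
driven by the random map `y ↦ φ(W y) / |φ(W y)|` (`LeakyReLUNet.projLayer`), and `log |X_ℓ|` is
`log |x₀|` plus the sum of the increments `log |φ(W_{k+1} Y_k)|`. The theorem is a law of large
numbers for this additive functional. It has three ingredients.

*Poisson equation implies the law of large numbers.* Suppose that the increments `F` have uniformly
bounded second moments and that their mean satisfies `E F(·, y) = lam + g(y) - (Pg)(y)` for a
bounded measurable `g` and the transition operator `P`. Then `∑ F - ℓ lam` differs by a bounded
term from a sum of orthogonal increments, whose second moment grows at most linearly, uniformly in
the starting point. Chebyshev's inequality along the squares and control of the gaps between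
consecutive squares give the almost sure statement, and the second moment bound itself gives
uniform convergence in `L¹`
(`RandomIteration.ae_tendsto_of_poisson`, `RandomIteration.exists_lintegral_abs_le_of_poisson`).

*Doeblin's condition implies the Poisson equation.* If some power `P^n` dominates a fixed nonzero
measure from every starting point, then `P^n` contracts oscillations, and a geometric series solves
the Poisson equation (`RandomIteration.exists_poisson_solution`).

*Doeblin's condition holds.* In both cases `μ` dominates, near a multiple `η • 1` of the identity,
a multiple of a measure `m` that is invariant under `W ↦ W R` for orthogonal `R`: Lebesgue measure
on matrices, respectively the Haar measure of `η • O(d)` (`LeakyReLUNet.IsLocallySpread`). Rotating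
`y'` to a nearby `y` therefore shows that the transition laws from all `y'` close to `y` dominate a
common measure, which charges every neighbourhood of `φ(z) / |φ(z)|` for all `z` close to `y`
(`LeakyReLUNet.IsLocallySpread.exists_lintegral_localLaw_le`). It remains to connect every point of
the sphere with the diagonal direction `u = (1, …, 1) / √d`. For `α > 0` the map
`z ↦ φ(z) / |φ(z)|` does not decrease `⟨u, z⟩`, so a maximizer of `⟨u, ·⟩` on the closed set of
points that are not yet connected could be improved by a small rotation, unless the dimension is
one; for `α < 0` the same argument works within the nonnegative orthant, which is entered in one
step (`LeakyReLUNet.eq_univ_of_pos`, `LeakyReLUNet.eq_univ_of_neg`). In dimension one with `α > 0`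
the two points of the sphere communicate because `det W < 0` has positive probability, and for
`α = 1` the mean increment is constant, so that no mixing is needed.

The second moment of `log |W y|` is finite because, for independent entries, a coordinate of `W y`
conditionally has a bounded density, which makes `|W y|^(-1/2)` integrable; in the orthogonal case
`|W y|` is constant (`LeakyReLUNet.HasLogMoment`).
-/

noncomputable section

namespace RandomIteration

/-! ### Random orbits and their cocycle sums -/

section orbit

variable {M S : Type*}

/-- The sequence `w, ω 0, ω 1, …`. -/
def seqCons (w : M) (ω : ℕ → M) : ℕ → M
  | 0 => w
  | n + 1 => ω n

/-- The orbit of `y` under the maps `Ψ (ω 0)`, `Ψ (ω 1)`, …, the first of which is applied first. -/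
def orbit (Ψ : M → S → S) (y : S) (ω : ℕ → M) : ℕ → S
  | 0 => y
  | n + 1 => Ψ (ω n) (orbit Ψ y ω n)

theorem orbit_seqCons (Ψ : M → S → S) (y : S) (w : M) (ω : ℕ → M) (n : ℕ) :
    orbit Ψ y (seqCons w ω) (n + 1) = orbit Ψ (Ψ w y) ω n := by
  induction n with
  | zero => rfl
  | succ n ih =>
    rw [orbit, ih]
    rfl

/-- The sum of `D` along the orbit of `y`, over the `n` times from `a` on. -/
def cocycleSum (Ψ : M → S → S) (D : M → S → ℝ) (a n : ℕ) (y : S) (ω : ℕ → M) : ℝ :=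
  ∑ k ∈ Finset.range n, D (ω (a + k)) (orbit Ψ y ω (a + k))

theorem cocycleSum_zero_succ_seqCons (Ψ : M → S → S) (D : M → S → ℝ) (n : ℕ) (y : S) (w : M)
    (ω : ℕ → M) :
    cocycleSum Ψ D 0 (n + 1) y (seqCons w ω) = D w y + cocycleSum Ψ D 0 n (Ψ w y) ω := by
  simp only [cocycleSum, zero_add]
  rw [Finset.sum_range_succ', add_comm]
  congr 1
  refine Finset.sum_congr rfl fun k _ => ?_
  rw [orbit_seqCons]
  rfl

theorem cocycleSum_succ_seqCons (Ψ : M → S → S) (D : M → S → ℝ) (a n : ℕ) (y : S) (w : M)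
    (ω : ℕ → M) :
    cocycleSum Ψ D (a + 1) n y (seqCons w ω) = cocycleSum Ψ D a n (Ψ w y) ω := by
  simp only [cocycleSum]
  refine Finset.sum_congr rfl fun k _ => ?_
  rw [show a + 1 + k = a + k + 1 by ring, orbit_seqCons]
  rfl

theorem cocycleSum_zero_add (Ψ : M → S → S) (D : M → S → ℝ) (a n : ℕ) (y : S) (ω : ℕ → M) :
    cocycleSum Ψ D 0 (a + n) y ω = cocycleSum Ψ D 0 a y ω + cocycleSum Ψ D a n y ω := by
  simp only [cocycleSum, zero_add]
  rw [Finset.sum_range_add]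

/-- Along an orbit, `F` differs from `F + g ∘ Ψ - lam - g`, which is centered if `g` solves the
Poisson equation, by the constant `lam` and a telescoping term. -/
theorem cocycleSum_eq_of_poisson (Ψ : M → S → S) (F : M → S → ℝ) (g : S → ℝ) (lam : ℝ) (n : ℕ)
    (y : S) (ω : ℕ → M) :
    cocycleSum Ψ F 0 n y ω =
      cocycleSum Ψ (fun w y => F w y + g (Ψ w y) - lam - g y) 0 n y ω + n * lam +
        (g y - g (orbit Ψ y ω n)) := by
  induction n with
  | zero => simp [cocycleSum, orbit]
  | succ n ih =>
    simp only [cocycleSum, zero_add] at ih ⊢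
    rw [Finset.sum_range_succ, Finset.sum_range_succ, ih, orbit]
    push_cast
    ring

variable [MeasurableSpace M] [MeasurableSpace S]

theorem measurable_seqCons : Measurable fun p : M × (ℕ → M) => seqCons p.1 p.2 := by
  refine measurable_pi_lambda _ fun n => ?_
  cases n with
  | zero => exact measurable_fst
  | succ n => exact (measurable_pi_apply n).comp measurable_snd

/-- Prepending an independent `μ`-distributed entry to an i.i.d. sequence gives an i.i.d. sequence.
This turns statements about orbits into inductions on the first step. -/
theorem map_seqCons (μ : Measure M) [IsProbabilityMeasure μ] :
    (μ.prod (Measure.infinitePi fun _ : ℕ => μ)).map (fun p => seqCons p.1 p.2) =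
      Measure.infinitePi fun _ : ℕ => μ := by
  classical
  refine Measure.eq_infinitePi _ fun s t ht => ?_
  rw [Measure.map_apply measurable_seqCons
    (MeasurableSet.pi s.countable_toSet fun i _ => ht i)]
  have hinj : Set.InjOn Nat.succ (Nat.succ ⁻¹' (s : Set ℕ)) := Nat.succ_injective.injOn
  have hpre : (fun p : M × (ℕ → M) => seqCons p.1 p.2) ⁻¹' (s : Set ℕ).pi t =
      (if 0 ∈ s then t 0 else Set.univ) ×ˢ
        ((s.preimage Nat.succ hinj : Finset ℕ) : Set ℕ).pi fun n => t (n + 1) := by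
    ext ⟨w, ω⟩
    simp only [Set.mem_preimage, Set.mem_pi, Finset.mem_coe, Set.mem_prod, Finset.mem_preimage]
    constructor
    · intro h
      refine ⟨?_, fun n hn => h (n + 1) hn⟩
      split_ifs with h0
      · exact h 0 h0
      · trivial
    · rintro ⟨h0, h1⟩ i hi
      cases i with
      | zero =>
        rw [if_pos hi] at h0
        exact h0
      | succ n => exact h1 n hi
  rw [hpre, Measure.prod_prod, Measure.infinitePi_pi _ fun i _ => ht _]
  have h2 := Finset.prod_preimage' Nat.succ s hinj fun i => μ (t i)
  simp only [Nat.succ_eq_add_one] at h2 ⊢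
  rw [h2]
  by_cases h0 : 0 ∈ s
  · rw [if_pos h0, ← Finset.mul_prod_erase s (fun i => μ (t i)) h0]
    congr 2
    ext i
    simp only [Finset.mem_filter, Set.mem_range, Finset.mem_erase]
    constructor
    · rintro ⟨hi, j, rfl⟩
      exact ⟨by omega, hi⟩
    · rintro ⟨hi, hs⟩
      exact ⟨hs, i - 1, by omega⟩
  · rw [if_neg h0, measure_univ, one_mul]
    congr 1
    ext i
    simp only [Finset.mem_filter, Set.mem_range, and_iff_left_iff_imp]
    intro hs
    exact ⟨i - 1, Nat.succ_pred_eq_of_ne_zero fun h => h0 (h ▸ hs)⟩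

theorem measurePreserving_seqCons (μ : Measure M) [IsProbabilityMeasure μ] :
    MeasurePreserving (fun p : M × (ℕ → M) => seqCons p.1 p.2)
      (μ.prod (Measure.infinitePi fun _ : ℕ => μ)) (Measure.infinitePi fun _ : ℕ => μ) :=
  ⟨measurable_seqCons, map_seqCons μ⟩

theorem lintegral_seqCons (μ : Measure M) [IsProbabilityMeasure μ] {f : (ℕ → M) → ℝ≥0∞}
    (hf : Measurable f) :
    ∫⁻ ω, f ω ∂(Measure.infinitePi fun _ : ℕ => μ) =
      ∫⁻ w, ∫⁻ ω, f (seqCons w ω) ∂(Measure.infinitePi fun _ : ℕ => μ) ∂μ := by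
  conv_lhs => rw [← map_seqCons μ]
  rw [lintegral_map hf measurable_seqCons]
  exact lintegral_prod _ (hf.comp measurable_seqCons).aemeasurable

theorem integral_seqCons (μ : Measure M) [IsProbabilityMeasure μ] {f : (ℕ → M) → ℝ}
    (hm : Measurable f) (hf : Integrable f (Measure.infinitePi fun _ : ℕ => μ)) :
    ∫ ω, f ω ∂(Measure.infinitePi fun _ : ℕ => μ) =
      ∫ w, ∫ ω, f (seqCons w ω) ∂(Measure.infinitePi fun _ : ℕ => μ) ∂μ := by
  have h1 : Integrable (fun p : M × (ℕ → M) => f (seqCons p.1 p.2))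
      (μ.prod (Measure.infinitePi fun _ : ℕ => μ)) :=
    (measurePreserving_seqCons μ).integrable_comp_of_integrable hf
  conv_lhs => rw [← map_seqCons μ]
  rw [integral_map measurable_seqCons.aemeasurable hm.aestronglyMeasurable, integral_prod _ h1]

section

variable {Ψ : M → S → S} (hΨ : Measurable fun p : M × S => Ψ p.1 p.2)
include hΨ

theorem measurable_orbit (n : ℕ) : Measurable fun p : S × (ℕ → M) => orbit Ψ p.1 p.2 n := by
  induction n with
  | zero => exact measurable_fst
  | succ n ih =>
    exact hΨ.comp (((measurable_pi_apply n).comp measurable_snd).prodMk ih)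

theorem measurable_orbit_right (y : S) (n : ℕ) : Measurable fun ω : ℕ → M => orbit Ψ y ω n :=
  (measurable_orbit hΨ n).comp measurable_prodMk_left

theorem measurable_cocycleSum {D : M → S → ℝ} (hD : Measurable fun p : M × S => D p.1 p.2)
    (a n : ℕ) (y : S) : Measurable fun ω => cocycleSum Ψ D a n y ω := by
  refine Finset.measurable_sum _ fun k _ => ?_
  exact hD.comp ((measurable_pi_apply (a + k)).prodMk (measurable_orbit_right hΨ y (a + k)))

end

theorem memLp_two_of_lintegral_sq_le {Ω : Type*} [MeasurableSpace Ω] {P : Measure Ω}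
    {X : Ω → ℝ} (hX : Measurable X) {K : ℝ}
    (h : ∫⁻ ω, ENNReal.ofReal (X ω ^ 2) ∂P ≤ ENNReal.ofReal K) : MemLp X 2 P := by
  rw [memLp_two_iff_integrable_sq hX.aestronglyMeasurable]
  refine ⟨(hX.pow_const 2).aestronglyMeasurable, ?_⟩
  rw [hasFiniteIntegral_iff_ofReal (ae_of_all _ fun ω => sq_nonneg _)]
  exact h.trans_lt ENNReal.ofReal_lt_top

theorem lintegral_const_add_sq_le {Ω : Type*} [MeasurableSpace Ω] {P : Measure Ω}
    [IsProbabilityMeasure P] {X : Ω → ℝ} (hX : Measurable X) {K : ℝ}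
    (h : ∫⁻ ω, ENNReal.ofReal (X ω ^ 2) ∂P ≤ ENNReal.ofReal K) (h0 : ∫ ω, X ω ∂P = 0) (c : ℝ) :
    ∫⁻ ω, ENNReal.ofReal ((c + X ω) ^ 2) ∂P ≤ ENNReal.ofReal (c ^ 2) + ENNReal.ofReal K := by
  have hL := memLp_two_of_lintegral_sq_le hX h
  have hsq : Integrable (fun ω => X ω ^ 2) P := hL.integrable_sq
  have hi : Integrable X P := hL.integrable (by norm_num)
  have hexp : ∀ ω, (c + X ω) ^ 2 = (c ^ 2 + 2 * c * X ω) + X ω ^ 2 := fun ω => by ring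
  have hint1 : Integrable (fun ω => c ^ 2 + 2 * c * X ω) P :=
    (integrable_const _).add (hi.const_mul _)
  have hint : Integrable (fun ω => (c + X ω) ^ 2) P := by
    simp_rw [hexp]
    exact hint1.add hsq
  rw [← ofReal_integral_eq_lintegral_ofReal hint (ae_of_all _ fun ω => sq_nonneg _)]
  rw [← ofReal_integral_eq_lintegral_ofReal hsq (ae_of_all _ fun ω => sq_nonneg _)] at h
  have : ∫ ω, (c + X ω) ^ 2 ∂P = c ^ 2 + ∫ ω, X ω ^ 2 ∂P := by
    simp_rw [hexp]
    rw [integral_add hint1 hsq, integral_add (integrable_const _) (hi.const_mul _),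
      integral_const_mul, h0]
    simp
  rw [this, ENNReal.ofReal_add (sq_nonneg _) (integral_nonneg fun ω => sq_nonneg _)]
  gcongr

section

variable {μ : Measure M} [IsProbabilityMeasure μ] {Ψ : M → S → S}
  (hΨ : Measurable fun p : M × S => Ψ p.1 p.2) {D : M → S → ℝ}
  (hD : Measurable fun p : M × S => D p.1 p.2) {C : ℝ} (hC : 0 ≤ C)
  (hD0 : ∀ y, ∫ w, D w y ∂μ = 0)
  (hD2 : ∀ y, ∫⁻ w, ENNReal.ofReal (D w y ^ 2) ∂μ ≤ ENNReal.ofReal C)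
include hΨ hD hC hD0 hD2

/-- Sums of centered increments along the orbit are centered and have second moment at most `n * C`.
Conditionally on the first step, the remaining sum is centered by the induction hypothesis, so no
cross term arises. -/
theorem cocycleSum_zero_moments (n : ℕ) (y : S) :
    (∫⁻ ω, ENNReal.ofReal (cocycleSum Ψ D 0 n y ω ^ 2) ∂(Measure.infinitePi fun _ : ℕ => μ) ≤
      ENNReal.ofReal (n * C)) ∧
    ∫ ω, cocycleSum Ψ D 0 n y ω ∂(Measure.infinitePi fun _ : ℕ => μ) = 0 := by
  induction n generalizing y with
  | zero => simp [cocycleSum]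
  | succ n ih =>
    have hm := measurable_cocycleSum hΨ hD 0
    have h2 : ∫⁻ ω, ENNReal.ofReal (cocycleSum Ψ D 0 (n + 1) y ω ^ 2)
        ∂(Measure.infinitePi fun _ : ℕ => μ) ≤ ENNReal.ofReal ((n + 1 : ℕ) * C) := by
      rw [lintegral_seqCons μ ((hm _ _).pow_const 2).ennreal_ofReal]
      simp_rw [cocycleSum_zero_succ_seqCons]
      calc _ ≤ ∫⁻ w, (ENNReal.ofReal (D w y ^ 2) + ENNReal.ofReal (n * C)) ∂μ :=
            lintegral_mono fun w =>
              lintegral_const_add_sq_le (hm _ _) (ih (Ψ w y)).1 (ih (Ψ w y)).2 _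
        _ ≤ ENNReal.ofReal C + ENNReal.ofReal (n * C) := by
            rw [lintegral_add_right _ measurable_const, lintegral_const, measure_univ, mul_one]
            gcongr
            exact hD2 y
        _ = ENNReal.ofReal ((n + 1 : ℕ) * C) := by
            rw [← ENNReal.ofReal_add hC (by positivity)]
            congr 1
            push_cast
            ring
    refine ⟨h2, ?_⟩
    have hint := (memLp_two_of_lintegral_sq_le (hm _ _) h2).integrable (by norm_num)
    rw [integral_seqCons μ (hm _ _) hint]
    simp_rw [cocycleSum_zero_succ_seqCons]
    have : ∀ w, ∫ ω, (D w y + cocycleSum Ψ D 0 n (Ψ w y) ω)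
        ∂(Measure.infinitePi fun _ : ℕ => μ) = D w y := by
      intro w
      have hi := (memLp_two_of_lintegral_sq_le (hm _ _) (ih (Ψ w y)).1).integrable (by norm_num)
      rw [integral_add (integrable_const _) hi, (ih (Ψ w y)).2]
      simp
    simp_rw [this]
    exact hD0 y

theorem lintegral_cocycleSum_sq_le (a n : ℕ) (y : S) :
    ∫⁻ ω, ENNReal.ofReal (cocycleSum Ψ D a n y ω ^ 2) ∂(Measure.infinitePi fun _ : ℕ => μ) ≤
      ENNReal.ofReal (n * C) := by
  induction a generalizing y with
  | zero => exact (cocycleSum_zero_moments hΨ hD hC hD0 hD2 n y).1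
  | succ a ih =>
    rw [lintegral_seqCons μ ((measurable_cocycleSum hΨ hD _ _ _).pow_const 2).ennreal_ofReal]
    simp_rw [cocycleSum_succ_seqCons]
    calc _ ≤ ∫⁻ w, ENNReal.ofReal (n * C) ∂μ := lintegral_mono fun w => ih (Ψ w y)
      _ = _ := by simp

end

/-- For `m n / n → 0` it suffices to control `m` along the squares and, between the consecutive
squares `k ^ 2` and `(k + 1) ^ 2`, the increments from `k ^ 2`. -/
theorem tendsto_div_of_tendsto_sq {m : ℕ → ℝ}
    (h : Tendsto (fun k : ℕ => (m (k ^ 2) / k ^ 2) ^ 2 +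
      ∑ n ∈ Finset.range (2 * k + 1), ((m (k ^ 2 + n) - m (k ^ 2)) / k ^ 2) ^ 2) atTop (𝓝 0)) :
    Tendsto (fun n : ℕ => m n / n) atTop (𝓝 0) := by
  set b : ℕ → ℝ := fun k => (m (k ^ 2) / k ^ 2) ^ 2 +
      ∑ n ∈ Finset.range (2 * k + 1), ((m (k ^ 2 + n) - m (k ^ 2)) / k ^ 2) ^ 2
  have hsqrt : Tendsto Nat.sqrt atTop atTop :=
    tendsto_atTop_mono' _ (Eventually.of_forall fun _ => le_rfl)
      (tendsto_atTop_atTop.2 fun c => ⟨c ^ 2, fun n hn => Nat.le_sqrt'.2 hn⟩)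
  have h1 : Tendsto (fun n : ℕ => 2 * Real.sqrt (b (Nat.sqrt n))) atTop (𝓝 0) := by
    have := ((h.comp hsqrt).sqrt).const_mul 2
    simpa using this
  refine squeeze_zero_norm' ?_ h1
  filter_upwards [eventually_ge_atTop 1] with n hn
  obtain ⟨k, hk⟩ : ∃ k, Nat.sqrt n = k := ⟨_, rfl⟩
  have hk1 : 1 ≤ k := hk ▸ Nat.le_sqrt'.2 (by simpa using hn)
  have hle : k ^ 2 ≤ n := hk ▸ Nat.sqrt_le' n
  have hlt : n < (k + 1) ^ 2 := hk ▸ Nat.lt_succ_sqrt' n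
  rw [hk]
  obtain ⟨j, rfl⟩ : ∃ j, n = k ^ 2 + j := ⟨n - k ^ 2, by omega⟩
  have hj : j ∈ Finset.range (2 * k + 1) := by
    rw [Finset.mem_range]
    nlinarith
  have hs0 : ∀ n ∈ Finset.range (2 * k + 1), 0 ≤ ((m (k ^ 2 + n) - m (k ^ 2)) / k ^ 2) ^ 2 :=
    fun _ _ => sq_nonneg _
  have e1 : |m (k ^ 2) / k ^ 2| ≤ Real.sqrt (b k) :=
    Real.abs_le_sqrt (le_add_of_nonneg_right (Finset.sum_nonneg hs0))
  have e2 : |(m (k ^ 2 + j) - m (k ^ 2)) / k ^ 2| ≤ Real.sqrt (b k) :=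
    Real.abs_le_sqrt ((Finset.single_le_sum hs0 hj).trans
      (le_add_of_nonneg_left (sq_nonneg _)))
  have hkpos : (0 : ℝ) < (k : ℝ) ^ 2 := by positivity
  calc ‖m (k ^ 2 + j) / ((k ^ 2 + j : ℕ) : ℝ)‖
      = |m (k ^ 2 + j)| / ((k ^ 2 + j : ℕ) : ℝ) := by
        rw [Real.norm_eq_abs, abs_div, Nat.abs_cast]
    _ ≤ |m (k ^ 2 + j)| / (k : ℝ) ^ 2 := by
        gcongr
        push_cast
        linarith [(Nat.cast_nonneg j : (0 : ℝ) ≤ j)]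
    _ = |m (k ^ 2 + j) / (k : ℝ) ^ 2| := by rw [abs_div, abs_of_pos hkpos]
    _ = |m (k ^ 2) / (k : ℝ) ^ 2 + (m (k ^ 2 + j) - m (k ^ 2)) / (k : ℝ) ^ 2| := by
        congr 1
        ring
    _ ≤ _ := (abs_add_le _ _).trans (by linarith)

section

variable {μ : Measure M} [IsProbabilityMeasure μ] {Ψ : M → S → S}
  (hΨ : Measurable fun p : M × S => Ψ p.1 p.2) {D : M → S → ℝ}
  (hD : Measurable fun p : M × S => D p.1 p.2) {C : ℝ} (hC : 0 ≤ C)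
  (hD0 : ∀ y, ∫ w, D w y ∂μ = 0)
  (hD2 : ∀ y, ∫⁻ w, ENNReal.ofReal (D w y ^ 2) ∂μ ≤ ENNReal.ofReal C)
include hΨ hD hC hD0 hD2

/-- Strong law of large numbers for centered increments with bounded second moments: the expectation
of the quantity that controls the sums between `k ^ 2` and `(k + 1) ^ 2` is at most `7 * C / k ^ 2`,
which is summable. -/
theorem ae_tendsto_cocycleSum_div (y : S) :
    ∀ᵐ ω ∂(Measure.infinitePi fun _ : ℕ => μ),
      Tendsto (fun n : ℕ => cocycleSum Ψ D 0 n y ω / n) atTop (𝓝 0) := by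
  set P := Measure.infinitePi fun _ : ℕ => μ with hP
  set b : ℕ → (ℕ → M) → ℝ := fun k ω => (cocycleSum Ψ D 0 (k ^ 2) y ω / k ^ 2) ^ 2 +
      ∑ n ∈ Finset.range (2 * k + 1), (cocycleSum Ψ D (k ^ 2) n y ω / k ^ 2) ^ 2 with hb
  have hm := measurable_cocycleSum hΨ hD
  have hbm : ∀ k, Measurable (b k) := fun k =>
    (((hm _ _ _).div_const _).pow_const 2).add
      (Finset.measurable_sum _ fun n _ => ((hm _ _ _).div_const _).pow_const 2)
  have hb0 : ∀ k ω, 0 ≤ b k ω := fun k ω =>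
    add_nonneg (sq_nonneg _) (Finset.sum_nonneg fun _ _ => sq_nonneg _)
  have hterm : ∀ a n k : ℕ,
      ∫⁻ ω, ENNReal.ofReal ((cocycleSum Ψ D a n y ω / k ^ 2) ^ 2) ∂P ≤
        ENNReal.ofReal (n * C / k ^ 4) := by
    intro a n k
    have hk4 : (0 : ℝ) ≤ ((k : ℝ) ^ 4)⁻¹ := by positivity
    have : ∀ ω, ENNReal.ofReal ((cocycleSum Ψ D a n y ω / k ^ 2) ^ 2) =
        ENNReal.ofReal ((k : ℝ) ^ 4)⁻¹ * ENNReal.ofReal (cocycleSum Ψ D a n y ω ^ 2) := by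
      intro ω
      rw [← ENNReal.ofReal_mul hk4]
      congr 1
      rw [div_pow, ← pow_mul, div_eq_inv_mul]
    simp_rw [this]
    rw [lintegral_const_mul _ ((hm _ _ _).pow_const 2).ennreal_ofReal,
      div_eq_inv_mul, ENNReal.ofReal_mul hk4]
    gcongr
    exact lintegral_cocycleSum_sq_le hΨ hD hC hD0 hD2 a n y
  have hbk : ∀ k : ℕ, ∫⁻ ω, ENNReal.ofReal (b k ω) ∂P ≤ ENNReal.ofReal (7 * C * (1 / k ^ 2)) := by
    intro k
    have hsplit : ∀ ω, ENNReal.ofReal (b k ω) =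
        ENNReal.ofReal ((cocycleSum Ψ D 0 (k ^ 2) y ω / k ^ 2) ^ 2) +
          ∑ n ∈ Finset.range (2 * k + 1),
            ENNReal.ofReal ((cocycleSum Ψ D (k ^ 2) n y ω / k ^ 2) ^ 2) := by
      intro ω
      rw [hb, ENNReal.ofReal_add (sq_nonneg _) (Finset.sum_nonneg fun _ _ => sq_nonneg _),
        ENNReal.ofReal_sum_of_nonneg fun _ _ => sq_nonneg _]
    simp_rw [hsplit]
    rw [lintegral_add_left (((hm _ _ _).div_const _).pow_const 2).ennreal_ofReal,
      lintegral_finsetSum _ fun n _ => (((hm _ _ _).div_const _).pow_const 2).ennreal_ofReal]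
    calc _ ≤ ENNReal.ofReal ((k ^ 2 : ℕ) * C / k ^ 4) +
          ∑ n ∈ Finset.range (2 * k + 1), ENNReal.ofReal ((2 * k : ℕ) * C / k ^ 4) := by
          refine add_le_add (hterm _ _ _) (Finset.sum_le_sum fun n hn => (hterm _ _ _).trans ?_)
          have : n ≤ 2 * k := Nat.lt_succ_iff.1 (Finset.mem_range.1 hn)
          gcongr
      _ = ENNReal.ofReal ((k ^ 2 : ℕ) * C / k ^ 4 + (2 * k + 1) * ((2 * k : ℕ) * C / k ^ 4)) := by
          rw [Finset.sum_const, Finset.card_range, nsmul_eq_mul, ENNReal.ofReal_add (by positivity)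
            (by positivity), ENNReal.ofReal_mul (by positivity)]
          congr 2
          rw [← ENNReal.ofReal_natCast]
          push_cast
          rfl
      _ ≤ _ := by
          refine ENNReal.ofReal_le_ofReal ?_
          rcases Nat.eq_zero_or_pos k with rfl | hk
          · simp
          · have hk' : (1 : ℝ) ≤ k := by exact_mod_cast hk
            have : (k ^ 2 : ℕ) * C / k ^ 4 + (2 * k + 1) * ((2 * k : ℕ) * C / k ^ 4) =
                (5 * k ^ 2 + 2 * k) * C / (k : ℝ) ^ 4 := by
              push_cast
              ring
            rw [this, div_le_iff₀ (by positivity)]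
            have e : 7 * C * (1 / (k : ℝ) ^ 2) * k ^ 4 = 7 * k ^ 2 * C := by
              field_simp
            rw [e]
            gcongr
            nlinarith
  have hsum : ∫⁻ ω, ∑' k, ENNReal.ofReal (b k ω) ∂P ≠ ⊤ := by
    rw [lintegral_tsum fun k => (hbm k).ennreal_ofReal.aemeasurable]
    refine ne_top_of_le_ne_top ?_ (ENNReal.tsum_le_tsum hbk)
    exact ((Real.summable_one_div_nat_pow.2 one_lt_two).mul_left (7 * C)).tsum_ofReal_ne_top
  filter_upwards [ae_lt_top (Measurable.tsum fun k => (hbm k).ennreal_ofReal) hsum] with ω hω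
  have h0 := ENNReal.tendsto_atTop_zero_of_tsum_ne_top hω.ne
  have h1 : Tendsto (fun k => b k ω) atTop (𝓝 0) := by
    have := (ENNReal.tendsto_toReal ENNReal.zero_ne_top).comp h0
    simpa [Function.comp_def, ENNReal.toReal_ofReal (hb0 _ ω)] using this
  refine tendsto_div_of_tendsto_sq ?_
  simpa only [cocycleSum_zero_add, add_sub_cancel_left] using h1

end

section

variable {μ : Measure M} [IsProbabilityMeasure μ] {Ψ : M → S → S}
  (hΨ : Measurable fun p : M × S => Ψ p.1 p.2) {F : M → S → ℝ}
  (hF : Measurable fun p : M × S => F p.1 p.2) {C : ℝ} (hC : 0 ≤ C)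
  (hF2 : ∀ y, ∫⁻ w, ENNReal.ofReal (F w y ^ 2) ∂μ ≤ ENNReal.ofReal C)
  {g : S → ℝ} (hg : Measurable g) {B : ℝ} (hB : ∀ y, |g y| ≤ B) {lam : ℝ}
  (hP : ∀ y, ∫ w, F w y ∂μ = lam + g y - ∫ w, g (Ψ w y) ∂μ)

include hΨ hF hC hF2 hg hB hP

theorem exists_centered_bound :
    Measurable (fun p : M × S => F p.1 p.2 + g (Ψ p.1 p.2) - lam - g p.2) ∧
    (∀ y, ∫ w, (F w y + g (Ψ w y) - lam - g y) ∂μ = 0) ∧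
    ∃ C', 0 ≤ C' ∧ ∀ y, ∫⁻ w, ENNReal.ofReal ((F w y + g (Ψ w y) - lam - g y) ^ 2) ∂μ ≤
      ENNReal.ofReal C' := by
  refine ⟨((hF.add (hg.comp hΨ)).sub_const _).sub (hg.comp measurable_snd), fun y => ?_,
    2 * C + 2 * (2 * B + |lam|) ^ 2, by positivity, fun y => ?_⟩
  · have hFy : Measurable fun w => F w y := hF.comp measurable_prodMk_right
    have hΨy : Measurable fun w => Ψ w y := hΨ.comp measurable_prodMk_right
    have i1 : Integrable (fun w => F w y) μ :=
      (memLp_two_of_lintegral_sq_le hFy (hF2 y)).integrable (by norm_num)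
    have i2 : Integrable (fun w => g (Ψ w y)) μ :=
      Integrable.of_bound (hg.comp hΨy).aestronglyMeasurable B (ae_of_all _ fun w => hB _)
    have i3 : Integrable (fun w => F w y + g (Ψ w y)) μ := i1.add i2
    have i4 : Integrable (fun w => F w y + g (Ψ w y) - lam) μ := i3.sub (integrable_const _)
    rw [integral_sub i4 (integrable_const _), integral_sub i3 (integrable_const _),
      integral_add i1 i2, hP y]
    simp
  · have hFy : Measurable fun w => F w y := hF.comp measurable_prodMk_right
    calc _ ≤ ∫⁻ w, (ENNReal.ofReal 2 * ENNReal.ofReal (F w y ^ 2) +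
          ENNReal.ofReal (2 * (2 * B + |lam|) ^ 2)) ∂μ := by
          refine lintegral_mono fun w => ?_
          rw [← ENNReal.ofReal_mul zero_le_two, ← ENNReal.ofReal_add (by positivity) (by positivity)]
          refine ENNReal.ofReal_le_ofReal ?_
          have h1 : |g (Ψ w y) - lam - g y| ≤ 2 * B + |lam| := by
            have := abs_le.1 (hB (Ψ w y))
            have := abs_le.1 (hB y)
            have := abs_le.1 (le_refl |lam|)
            exact abs_le.2 ⟨by linarith, by linarith⟩
          have h2 := sq_le_sq' (abs_le.1 h1).1 (abs_le.1 h1).2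
          nlinarith [sq_nonneg (F w y - (g (Ψ w y) - lam - g y))]
      _ ≤ ENNReal.ofReal 2 * ENNReal.ofReal C + ENNReal.ofReal (2 * (2 * B + |lam|) ^ 2) := by
          rw [lintegral_add_right _ measurable_const,
            lintegral_const_mul _ (hFy.pow_const 2).ennreal_ofReal, lintegral_const, measure_univ,
            mul_one]
          gcongr
          exact hF2 y
      _ = _ := by
          rw [← ENNReal.ofReal_mul zero_le_two, ← ENNReal.ofReal_add (by positivity) (by positivity)]

theorem ae_tendsto_of_poisson (y : S) :
    ∀ᵐ ω ∂(Measure.infinitePi fun _ : ℕ => μ),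
      Tendsto (fun n : ℕ => cocycleSum Ψ F 0 n y ω / n) atTop (𝓝 lam) := by
  obtain ⟨hD, hD0, C', hC', hD2⟩ := exists_centered_bound hΨ hF hC hF2 hg hB hP
  filter_upwards [ae_tendsto_cocycleSum_div hΨ hD hC' hD0 hD2 y] with ω hω
  have h1 : Tendsto (fun n : ℕ => (g y - g (orbit Ψ y ω n)) / n) atTop (𝓝 0) := by
    refine squeeze_zero_norm (a := fun n : ℕ => 2 * B / n) (fun n => ?_)
      (tendsto_const_div_atTop_nhds_zero_nat _)
    rw [Real.norm_eq_abs, abs_div, Nat.abs_cast]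
    gcongr
    exact (abs_sub _ _).trans (by linarith [hB y, hB (orbit Ψ y ω n)])
  have h2 := (hω.add_const lam).add h1
  rw [zero_add, add_zero] at h2
  refine h2.congr' ?_
  filter_upwards [eventually_ge_atTop 1] with n hn
  have hn' : (n : ℝ) ≠ 0 := by positivity
  rw [cocycleSum_eq_of_poisson Ψ F g lam]
  field_simp

theorem exists_lintegral_abs_le_of_poisson :
    ∃ K : ℝ, ∀ n : ℕ, 1 ≤ n → ∀ y, ∫⁻ ω, ENNReal.ofReal |cocycleSum Ψ F 0 n y ω / n - lam|
      ∂(Measure.infinitePi fun _ : ℕ => μ) ≤ ENNReal.ofReal (K / Real.sqrt n) := by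
  obtain ⟨hD, hD0, C', hC', hD2⟩ := exists_centered_bound hΨ hF hC hF2 hg hB hP
  refine ⟨1 / 2 + 2 * B + C' / 2, fun n hn y => ?_⟩
  have hB0 : 0 ≤ B := (abs_nonneg _).trans (hB y)
  set D : M → S → ℝ := fun w y => F w y + g (Ψ w y) - lam - g y with hDdef
  set s := Real.sqrt n
  have hs1 : 1 ≤ s := Real.one_le_sqrt.2 (by exact_mod_cast hn)
  have hs0 : 0 < s := by linarith
  have hsn : (n : ℝ) = s ^ 2 := (Real.sq_sqrt (Nat.cast_nonneg n)).symm
  have hc0 : 0 ≤ (2 * s ^ 3)⁻¹ := by positivity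
  have hpt : ∀ ω, ENNReal.ofReal |cocycleSum Ψ F 0 n y ω / n - lam| ≤
      ENNReal.ofReal ((1 / 2 + 2 * B) / s) +
        ENNReal.ofReal (2 * s ^ 3)⁻¹ * ENNReal.ofReal (cocycleSum Ψ D 0 n y ω ^ 2) := by
    intro ω
    rw [← ENNReal.ofReal_mul hc0, ← ENNReal.ofReal_add (by positivity) (by positivity)]
    refine ENNReal.ofReal_le_ofReal ?_
    set m := cocycleSum Ψ D 0 n y ω with hm
    have e : cocycleSum Ψ F 0 n y ω / n - lam = m / s ^ 2 + (g y - g (orbit Ψ y ω n)) / s ^ 2 := by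
      rw [cocycleSum_eq_of_poisson Ψ F g lam, ← hDdef, ← hm, hsn]
      field_simp
      ring
    rw [e]
    -- The inequality of arithmetic and geometric means, with weights chosen for `m ^ 2 ∼ n = s ^ 2`.
    have h1 : |m / s ^ 2| ≤ 1 / 2 / s + (2 * s ^ 3)⁻¹ * m ^ 2 := by
      rw [abs_div, abs_of_pos (by positivity : 0 < s ^ 2), div_le_iff₀ (by positivity), ← sq_abs m]
      have : (1 / 2 / s + (2 * s ^ 3)⁻¹ * |m| ^ 2) * s ^ 2 = (s ^ 2 + |m| ^ 2) / (2 * s) := by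
        field_simp
      rw [this, le_div_iff₀ (by positivity)]
      nlinarith [sq_nonneg (s - |m|)]
    have h2 : |(g y - g (orbit Ψ y ω n)) / s ^ 2| ≤ 2 * B / s := by
      rw [abs_div, abs_of_pos (by positivity : 0 < s ^ 2)]
      have h3 : |g y - g (orbit Ψ y ω n)| ≤ 2 * B :=
        (abs_sub _ _).trans (by linarith [hB y, hB (orbit Ψ y ω n)])
      have h4 : s ≤ s ^ 2 := by nlinarith
      exact div_le_div₀ (by positivity) h3 hs0 h4
    calc _ ≤ _ := abs_add_le _ _
      _ ≤ _ := add_le_add h1 h2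
      _ = _ := by ring
  calc _ ≤ _ := lintegral_mono hpt
    _ ≤ ENNReal.ofReal ((1 / 2 + 2 * B) / s) +
        ENNReal.ofReal (2 * s ^ 3)⁻¹ * ENNReal.ofReal (n * C') := by
        rw [lintegral_add_left measurable_const, lintegral_const_mul _
          ((measurable_cocycleSum hΨ hD 0 n y).pow_const 2).ennreal_ofReal, lintegral_const,
          measure_univ, mul_one]
        gcongr
        exact lintegral_cocycleSum_sq_le hΨ hD hC' hD0 hD2 0 n y
    _ = _ := by
        rw [← ENNReal.ofReal_mul hc0, ← ENNReal.ofReal_add (by positivity) (by positivity), hsn]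
        congr 1
        field_simp

end

end orbit

/-! ### Transfer operators and the Poisson equation -/

section

variable {M S : Type*} [MeasurableSpace M]

/-- The transition operator `h ↦ E h(Ψ(w, ·))` on real functions. -/
def transfer (μ : Measure M) (Ψ : M → S → S) (h : S → ℝ) (y : S) : ℝ := ∫ w, h (Ψ w y) ∂μ

/-- The transition operator on `ℝ≥0∞`-valued functions. -/
def lintegralTransfer (μ : Measure M) (Ψ : M → S → S) (h : S → ℝ≥0∞) (y : S) : ℝ≥0∞ :=
  ∫⁻ w, h (Ψ w y) ∂μ

variable {μ : Measure M} {Ψ : M → S → S}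

theorem abs_transfer_le [IsProbabilityMeasure μ] {h : S → ℝ} {B : ℝ} (hB : ∀ y, |h y| ≤ B) (y : S) :
    |transfer μ Ψ h y| ≤ B := by
  have := norm_integral_le_of_norm_le_const (μ := μ) (f := fun w => h (Ψ w y))
    (ae_of_all _ fun w => hB (Ψ w y))
  simpa [transfer] using this

theorem iterate_transfer_neg (h : S → ℝ) (n : ℕ) :
    (transfer μ Ψ)^[n] (fun y => -h y) = fun y => -(transfer μ Ψ)^[n] h y := by
  induction n generalizing h with
  | zero => rfl
  | succ n ih =>
    have : transfer μ Ψ (fun y => -h y) = fun y => -transfer μ Ψ h y := by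
      ext y
      exact integral_neg _
    rw [Function.iterate_succ_apply, this, ih]
    rfl

theorem iterate_transfer_nonneg {h : S → ℝ} (h0 : ∀ y, 0 ≤ h y) (n : ℕ) (y : S) :
    0 ≤ (transfer μ Ψ)^[n] h y := by
  induction n generalizing h with
  | zero => exact h0 y
  | succ n ih => exact ih fun y => integral_nonneg fun w => h0 _

variable [MeasurableSpace S]

/-- Bounded measurable real functions, on which the transition operator acts. -/
def BoundedMeasurable (h : S → ℝ) : Prop := Measurable h ∧ ∃ B, ∀ y, |h y| ≤ B

theorem BoundedMeasurable.sub_const {h : S → ℝ} (hh : BoundedMeasurable h) (a : ℝ) :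
    BoundedMeasurable fun y => h y - a := by
  obtain ⟨hm, B, hB⟩ := hh
  refine ⟨hm.sub_const a, B + |a|, fun y => ?_⟩
  exact (abs_sub _ _).trans (by linarith [hB y])

theorem BoundedMeasurable.neg {h : S → ℝ} (hh : BoundedMeasurable h) :
    BoundedMeasurable fun y => -h y := by
  obtain ⟨hm, B, hB⟩ := hh
  exact ⟨hm.neg, B, fun y => by rw [abs_neg]; exact hB y⟩

variable [IsProbabilityMeasure μ] (hΨ : Measurable fun p : M × S => Ψ p.1 p.2)
include hΨ

theorem BoundedMeasurable.integrable_comp {h : S → ℝ} (hh : BoundedMeasurable h) (y : S) :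
    Integrable (fun w => h (Ψ w y)) μ := by
  obtain ⟨hm, B, hB⟩ := hh
  exact Integrable.of_bound
    (hm.comp (hΨ.comp measurable_prodMk_right)).aestronglyMeasurable B (ae_of_all _ fun w => hB _)

theorem measurable_lintegralTransfer {h : S → ℝ≥0∞} (hh : Measurable h) :
    Measurable (lintegralTransfer μ Ψ h) :=
  (hh.comp hΨ).lintegral_prod_left'

theorem BoundedMeasurable.transfer {h : S → ℝ} (hh : BoundedMeasurable h) :
    BoundedMeasurable (transfer μ Ψ h) := by
  obtain ⟨hm, B, hB⟩ := hh
  exact ⟨(hm.comp hΨ).stronglyMeasurable.integral_prod_left'.measurable, B, abs_transfer_le hB⟩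

theorem BoundedMeasurable.iterate_transfer {h : S → ℝ} (hh : BoundedMeasurable h) (n : ℕ) :
    BoundedMeasurable ((RandomIteration.transfer μ Ψ)^[n] h) := by
  induction n generalizing h with
  | zero => exact hh
  | succ n ih => exact ih (hh.transfer hΨ)

theorem transfer_sub_const {h : S → ℝ} (hh : BoundedMeasurable h) (a : ℝ) :
    transfer μ Ψ (fun y => h y - a) = fun y => transfer μ Ψ h y - a := by
  ext y
  simp only [transfer]
  rw [integral_sub (hh.integrable_comp hΨ y) (integrable_const _)]
  simp

theorem iterate_transfer_sub_const {h : S → ℝ} (hh : BoundedMeasurable h) (a : ℝ) (n : ℕ) :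
    (transfer μ Ψ)^[n] (fun y => h y - a) = fun y => (transfer μ Ψ)^[n] h y - a := by
  induction n generalizing h with
  | zero => rfl
  | succ n ih =>
    rw [Function.iterate_succ_apply, transfer_sub_const hΨ hh, ih (hh.transfer hΨ)]
    rfl

theorem ofReal_iterate_transfer {h : S → ℝ} (hh : BoundedMeasurable h) (h0 : ∀ y, 0 ≤ h y)
    (n : ℕ) (y : S) :
    ENNReal.ofReal ((transfer μ Ψ)^[n] h y) =
      (lintegralTransfer μ Ψ)^[n] (fun y => ENNReal.ofReal (h y)) y := by
  induction n generalizing h with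
  | zero => rfl
  | succ n ih =>
    rw [Function.iterate_succ_apply, Function.iterate_succ_apply,
      ih (hh.transfer hΨ) fun y => integral_nonneg fun w => h0 _]
    refine congrArg (fun k => (lintegralTransfer μ Ψ)^[n] k y) (funext fun y => ?_)
    exact ofReal_integral_eq_lintegral_ofReal (hh.integrable_comp hΨ y) (ae_of_all _ fun w => h0 _)

theorem iterate_transfer_mem_Icc {h : S → ℝ} (hh : BoundedMeasurable h) {a b : ℝ}
    (hab : ∀ y, h y ∈ Set.Icc a b) (n : ℕ) (y : S) :
    (transfer μ Ψ)^[n] h y ∈ Set.Icc a b := by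
  have h1 := iterate_transfer_nonneg (μ := μ) (Ψ := Ψ) (h := fun y => h y - a)
    (fun y => sub_nonneg.2 (hab y).1) n y
  rw [iterate_transfer_sub_const hΨ hh] at h1
  have h2 := iterate_transfer_nonneg (μ := μ) (Ψ := Ψ) (h := fun y => -h y - -b)
    (fun y => by have := (hab y).2; simpa using this) n y
  rw [iterate_transfer_sub_const hΨ hh.neg, iterate_transfer_neg] at h2
  exact ⟨by linarith, by linarith⟩

theorem integral_le_iterate_transfer {ν : Measure S} [IsFiniteMeasure ν] {n : ℕ}
    (hν : ∀ y, ∀ h : S → ℝ≥0∞, Measurable h → ∫⁻ z, h z ∂ν ≤ (lintegralTransfer μ Ψ)^[n] h y)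
    {h : S → ℝ} (hh : BoundedMeasurable h) (h0 : ∀ y, 0 ≤ h y) (y : S) :
    ∫ z, h z ∂ν ≤ (transfer μ Ψ)^[n] h y := by
  have h1 := hν y _ hh.1.ennreal_ofReal
  rw [← ofReal_iterate_transfer hΨ hh h0] at h1
  have hi : Integrable h ν := by
    obtain ⟨hm, B, hB⟩ := hh
    exact Integrable.of_bound hm.aestronglyMeasurable B (ae_of_all _ fun w => hB _)
  rw [← ofReal_integral_eq_lintegral_ofReal hi (ae_of_all _ h0)] at h1
  exact (ENNReal.ofReal_le_ofReal_iff (iterate_transfer_nonneg h0 n y)).1 h1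

/-- If the `n`-step transition laws all dominate `ν`, the `n`-step transition operator contracts the
range of a function by the factor `1 - ν univ`. -/
theorem exists_iterate_transfer_mem_Icc {ν : Measure S} [IsFiniteMeasure ν] {n : ℕ}
    (hν : ∀ y, ∀ h : S → ℝ≥0∞, Measurable h → ∫⁻ z, h z ∂ν ≤ (lintegralTransfer μ Ψ)^[n] h y)
    {h : S → ℝ} (hh : BoundedMeasurable h) {a b : ℝ} (hab : ∀ y, h y ∈ Set.Icc a b) :
    ∃ a' b', b' - a' = (1 - ν.real Set.univ) * (b - a) ∧
      ∀ y, (transfer μ Ψ)^[n] h y ∈ Set.Icc a' b' := by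
  have hi : Integrable h ν := by
    obtain ⟨hm, B, hB⟩ := hh
    exact Integrable.of_bound hm.aestronglyMeasurable B (ae_of_all _ fun w => hB _)
  set t := ν.real Set.univ
  set I := ∫ z, h z ∂ν
  refine ⟨a + (I - t * a), b - (t * b - I), by ring, fun y => ⟨?_, ?_⟩⟩
  · have h1 := integral_le_iterate_transfer hΨ hν (hh.sub_const a)
      (fun y => sub_nonneg.2 (hab y).1) y
    rw [iterate_transfer_sub_const hΨ hh, integral_sub hi (integrable_const _), integral_const,
      smul_eq_mul] at h1
    linarith
  · have h1 := integral_le_iterate_transfer hΨ hν (hh.neg.sub_const (-b))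
      (fun y => by have := (hab y).2; simpa using this) y
    rw [iterate_transfer_sub_const hΨ hh.neg, iterate_transfer_neg,
      integral_sub (f := fun z => -h z) hi.neg (integrable_const _), integral_neg, integral_const, smul_eq_mul] at h1
    linarith

/-- Under Doeblin's condition, `P^(n k) f` converges to a constant, uniformly and geometrically. -/
theorem exists_iterate_transfer_sub_le {ν : Measure S} [IsFiniteMeasure ν] [NeZero ν] {n : ℕ}
    (hν : ∀ y, ∀ h : S → ℝ≥0∞, Measurable h → ∫⁻ z, h z ∂ν ≤ (lintegralTransfer μ Ψ)^[n] h y)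
    {f : S → ℝ} (hf : BoundedMeasurable f) :
    ∃ lam K q : ℝ, 0 ≤ q ∧ q < 1 ∧
      ∀ (k : ℕ) (y : S), |(transfer μ Ψ)^[n * k] f y - lam| ≤ K * q ^ k := by
  obtain ⟨hm, B, hB⟩ := id hf
  -- Nested intervals contain all later iterates; the limit at one point lies in all of them.
  obtain ⟨y₀⟩ : Nonempty S := ν.nonempty_of_neZero
  set q := 1 - ν.real Set.univ with hq
  have ht0 : 0 < ν.real Set.univ := measureReal_univ_pos
  have ht1 : ν.real Set.univ ≤ 1 := by
    have h1 := integral_le_iterate_transfer (h := fun _ => (1 : ℝ)) hΨ hν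
      ⟨measurable_const, 1, fun y => by simp⟩ (fun _ => zero_le_one) y₀
    have h2 := (iterate_transfer_mem_Icc (μ := μ) hΨ (h := fun _ => (1 : ℝ)) (a := 1) (b := 1)
      ⟨measurable_const, 1, fun y => by simp⟩ (fun _ => by simp) n y₀).2
    rw [integral_const, smul_eq_mul, mul_one] at h1
    exact h1.trans h2
  have hosc : ∀ k : ℕ, ∃ a b, b - a = 2 * B * q ^ k ∧
      ∀ y, (transfer μ Ψ)^[n * k] f y ∈ Set.Icc a b := by
    intro k
    induction k with
    | zero => exact ⟨-B, B, by ring, fun y => abs_le.1 (hB y)⟩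
    | succ k ih =>
      obtain ⟨a, b, hab, hmem⟩ := ih
      obtain ⟨a', b', hab', hmem'⟩ :=
        exists_iterate_transfer_mem_Icc hΨ hν (hf.iterate_transfer hΨ (n * k)) hmem
      refine ⟨a', b', by rw [hab', hab]; ring, fun y => ?_⟩
      have := hmem' y
      rwa [← Function.iterate_add_apply, show n + n * k = n * (k + 1) by ring] at this
  have hq0 : 0 ≤ q := by linarith
  have hq1 : q < 1 := by linarith
  choose a b hab hmem using hosc
  have hlater : ∀ k m y, (transfer μ Ψ)^[n * (k + m)] f y ∈ Set.Icc (a k) (b k) := by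
    intro k m y
    rw [show n * (k + m) = n * m + n * k by ring, Function.iterate_add_apply]
    exact iterate_transfer_mem_Icc hΨ (hf.iterate_transfer hΨ _) (hmem k) _ y
  have hcauchy : CauchySeq fun k => (transfer μ Ψ)^[n * k] f y₀ := by
    refine cauchySeq_of_le_geometric q (2 * B) hq1 fun k => ?_
    rw [Real.dist_eq, ← hab k]
    exact abs_sub_le_of_le_of_le (hmem k y₀).1 (hmem k y₀).2 (hlater k 1 y₀).1 (hlater k 1 y₀).2
  obtain ⟨lam, hlam⟩ := cauchySeq_tendsto_of_complete hcauchy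
  refine ⟨lam, 2 * B, q, hq0, hq1, fun k y => ?_⟩
  have hl : lam ∈ Set.Icc (a k) (b k) := by
    refine isClosed_Icc.mem_of_tendsto hlam ?_
    filter_upwards [eventually_ge_atTop k] with m hm
    obtain ⟨j, rfl⟩ := Nat.exists_eq_add_of_le hm
    exact hlater k j y₀
  rw [← hab k]
  exact abs_sub_le_of_le_of_le (hmem k y).1 (hmem k y).2 hl.1 hl.2

theorem transfer_tsum {u : ℕ → S → ℝ} (hu : ∀ k, Measurable (u k)) {c : ℕ → ℝ} (hc : Summable c)
    (hb : ∀ k y, |u k y| ≤ c k) :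
    transfer μ Ψ (fun y => ∑' k, u k y) = fun y => ∑' k, transfer μ Ψ (u k) y := by
  ext y
  have hi : ∀ k, Integrable (fun w => u k (Ψ w y)) μ := fun k =>
    BoundedMeasurable.integrable_comp hΨ ⟨hu k, c k, hb k⟩ y
  refine (integral_tsum_of_summable_integral_norm hi ?_).symm
  refine Summable.of_nonneg_of_le (fun k => integral_nonneg fun w => norm_nonneg _) (fun k => ?_) hc
  calc _ ≤ ∫ w, c k ∂μ := integral_mono (hi k).norm (integrable_const _) fun w => hb k _
    _ = c k := by simp

theorem iterate_transfer_tsum {u : ℕ → S → ℝ} (hu : ∀ k, BoundedMeasurable (u k)) {c : ℕ → ℝ}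
    (hc : Summable c) (hb : ∀ k y, |u k y| ≤ c k) (n : ℕ) :
    (transfer μ Ψ)^[n] (fun y => ∑' k, u k y) = fun y => ∑' k, (transfer μ Ψ)^[n] (u k) y := by
  induction n generalizing u with
  | zero => rfl
  | succ n ih =>
    rw [Function.iterate_succ_apply, transfer_tsum hΨ (fun k => (hu k).1) hc hb,
      ih (fun k => (hu k).transfer hΨ) fun k y => abs_transfer_le (hb k) y]
    rfl

/-- Under Doeblin's condition the Poisson equation is solvable for each bounded measurable `f`. With
`G = ∑ k, (P^(n k) f - lam)`, which satisfies `G - P^n G = f - lam`, the function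
`∑ i < n, P^i G` is a solution. -/
theorem exists_poisson_solution {ν : Measure S} [IsFiniteMeasure ν] [NeZero ν] {n : ℕ}
    (hν : ∀ y, ∀ h : S → ℝ≥0∞, Measurable h → ∫⁻ z, h z ∂ν ≤ (lintegralTransfer μ Ψ)^[n] h y)
    {f : S → ℝ} (hf : BoundedMeasurable f) :
    ∃ (lam : ℝ) (g : S → ℝ), BoundedMeasurable g ∧ ∀ y, f y = lam + g y - transfer μ Ψ g y := by
  obtain ⟨lam, K, q, hq0, hq1, hK⟩ := exists_iterate_transfer_sub_le hΨ hν hf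
  set u : ℕ → S → ℝ := fun k y => (transfer μ Ψ)^[n * k] f y - lam with hu
  have hubm : ∀ k, BoundedMeasurable (u k) := fun k => (hf.iterate_transfer hΨ _).sub_const lam
  have hc : Summable fun k => K * q ^ k := (summable_geometric_of_lt_one hq0 hq1).mul_left K
  have hsum : ∀ y, Summable fun k => u k y := fun y =>
    Summable.of_norm_bounded hc fun k => hK k y
  set G : S → ℝ := fun y => ∑' k, u k y with hG
  have hGbm : BoundedMeasurable G := by
    refine ⟨measurable_of_tendsto_metrizable
      (f := fun N y => ∑ k ∈ Finset.range N, u k y)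
      (fun N => Finset.measurable_sum _ fun k _ => (hubm k).1)
      (tendsto_pi_nhds.2 fun y => (hsum y).hasSum.tendsto_sum_nat), ∑' k, K * q ^ k, fun y => ?_⟩
    exact tsum_of_norm_bounded (f := fun k => u k y) hc.hasSum fun k => hK k y
  have hPu : ∀ k, (transfer μ Ψ)^[n] (u k) = u (k + 1) := by
    intro k
    rw [hu]
    simp only
    rw [iterate_transfer_sub_const hΨ (hf.iterate_transfer hΨ _), ← Function.iterate_add_apply,
      show n + n * k = n * (k + 1) by ring]
  have hPG : ∀ y, G y - (transfer μ Ψ)^[n] G y = f y - lam := by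
    intro y
    rw [hG, iterate_transfer_tsum hΨ hubm hc hK]
    simp only [hPu]
    rw [(hsum y).tsum_eq_zero_add]
    simp [hu]
  refine ⟨lam, fun y => ∑ i ∈ Finset.range n, (transfer μ Ψ)^[i] G y, ?_, fun y => ?_⟩
  · have hbm := fun i => hGbm.iterate_transfer (μ := μ) hΨ i
    choose B hB using fun i => (hbm i).2
    refine ⟨Finset.measurable_sum _ fun i _ => (hbm i).1, ∑ i ∈ Finset.range n, B i, fun y => ?_⟩
    exact (Finset.abs_sum_le_sum_abs _ _).trans (Finset.sum_le_sum fun i _ => hB i y)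
  · have h1 : transfer μ Ψ (fun y => ∑ i ∈ Finset.range n, (transfer μ Ψ)^[i] G y) y =
        ∑ i ∈ Finset.range n, (transfer μ Ψ)^[i + 1] G y := by
      simp only [transfer]
      rw [integral_finsetSum _ fun i _ => (hGbm.iterate_transfer hΨ i).integrable_comp hΨ y]
      refine Finset.sum_congr rfl fun i _ => ?_
      rw [Function.iterate_succ_apply']
      rfl
    have h2 := Finset.sum_range_sub (fun i => (transfer μ Ψ)^[i] G y) n
    rw [Finset.sum_sub_distrib] at h2
    have h3 := hPG y
    rw [h1]
    simp only [Function.iterate_zero, id_eq] at h2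
    linarith

end

/-! ### Minorization of transition kernels -/

section

variable {M S : Type*} [MeasurableSpace M] [MeasurableSpace S]

/-- The `n`-step transition laws from all points of `V` dominate a common positive multiple of `ν`. -/
def MinorizedOn (μ : Measure M) (Ψ : M → S → S) (ν : Measure S) (n : ℕ) (V : Set S) : Prop :=
  ∃ c : ℝ≥0∞, c ≠ 0 ∧ ∀ y ∈ V, ∀ h : S → ℝ≥0∞, Measurable h →
    c * ∫⁻ z, h z ∂ν ≤ (lintegralTransfer μ Ψ)^[n] h y

variable {μ : Measure M} {Ψ : M → S → S} {ν : Measure S} {n : ℕ} {U V : Set S}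

theorem MinorizedOn.mono (h : MinorizedOn μ Ψ ν n V) (hU : U ⊆ V) : MinorizedOn μ Ψ ν n U := by
  obtain ⟨c, hc, h⟩ := h
  exact ⟨c, hc, fun y hy => h y (hU hy)⟩

theorem MinorizedOn.union (hU : MinorizedOn μ Ψ ν n U) (hV : MinorizedOn μ Ψ ν n V) :
    MinorizedOn μ Ψ ν n (U ∪ V) := by
  obtain ⟨c, hc, hU⟩ := hU
  obtain ⟨c', hc', hV⟩ := hV
  refine ⟨min c c', (lt_min (pos_iff_ne_zero.2 hc) (pos_iff_ne_zero.2 hc')).ne', ?_⟩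
  rintro y (hy | hy) h hh
  · exact le_trans (by gcongr; exact min_le_left _ _) (hU y hy h hh)
  · exact le_trans (by gcongr; exact min_le_right _ _) (hV y hy h hh)

/-- If a set `U` with an `n`-step minorization is hit in one step with probability at least `δ` from
each point of `V`, then `V` has an `(n + 1)`-step minorization. -/
theorem MinorizedOn.of_hitting (hU : MinorizedOn μ Ψ ν n U) {δ : ℝ≥0∞} (hδ : δ ≠ 0)
    (hV : ∀ y ∈ V, δ ≤ lintegralTransfer μ Ψ (U.indicator 1) y) : MinorizedOn μ Ψ ν (n + 1) V := by
  obtain ⟨c, hc, hU⟩ := hU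
  refine ⟨c * δ, mul_ne_zero hc hδ, fun y hy h hh => ?_⟩
  rw [Function.iterate_succ_apply']
  calc c * δ * ∫⁻ z, h z ∂ν = (c * ∫⁻ z, h z ∂ν) * δ := by ring
    _ ≤ (c * ∫⁻ z, h z ∂ν) * ∫⁻ w, U.indicator 1 (Ψ w y) ∂μ := by
        gcongr
        exact hV y hy
    _ ≤ ∫⁻ w, (c * ∫⁻ z, h z ∂ν) * U.indicator 1 (Ψ w y) ∂μ := lintegral_const_mul_le _ _
    _ ≤ _ := by
        refine lintegral_mono fun w => ?_
        by_cases hw : Ψ w y ∈ U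
        · simpa [hw] using hU _ hw h hh
        · simp [hw]

/-- If `ν` charges a set from whose points the one-step laws dominate `ν`, a minorization by `ν` in
`n` steps yields one in `n + 1` steps. Hence numbers of steps can be equalized, and periodicity is no
obstruction. -/
theorem MinorizedOn.succ [IsProbabilityMeasure μ] (hΨ : Measurable fun p : M × S => Ψ p.1 p.2)
    (hV : MinorizedOn μ Ψ ν n V) (hUm : MeasurableSet U) (hU0 : ν U ≠ 0)
    (hU : ∀ y ∈ U, ∀ h : S → ℝ≥0∞, Measurable h → ∫⁻ z, h z ∂ν ≤ lintegralTransfer μ Ψ h y) :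
    MinorizedOn μ Ψ ν (n + 1) V := by
  obtain ⟨c, hc, hV⟩ := hV
  refine ⟨c * ν U, mul_ne_zero hc hU0, fun y hy h hh => ?_⟩
  rw [Function.iterate_succ_apply]
  refine le_trans ?_ (hV y hy _ (measurable_lintegralTransfer hΨ hh))
  rw [mul_assoc]
  gcongr
  calc ν U * ∫⁻ z, h z ∂ν = ∫⁻ _ in U, (∫⁻ z, h z ∂ν) ∂ν := by
        rw [setLIntegral_const, mul_comm]
    _ ≤ ∫⁻ y in U, lintegralTransfer μ Ψ h y ∂ν := setLIntegral_mono' hUm fun y hy => hU y hy h hh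
    _ ≤ _ := setLIntegral_le_lintegral _ _

theorem MinorizedOn.le [IsProbabilityMeasure μ] (hΨ : Measurable fun p : M × S => Ψ p.1 p.2)
    (hV : MinorizedOn μ Ψ ν n V) (hUm : MeasurableSet U) (hU0 : ν U ≠ 0)
    (hU : ∀ y ∈ U, ∀ h : S → ℝ≥0∞, Measurable h → ∫⁻ z, h z ∂ν ≤ lintegralTransfer μ Ψ h y)
    {k : ℕ} (hk : n ≤ k) : MinorizedOn μ Ψ ν k V := by
  induction k, hk using Nat.le_induction with
  | base => exact hV
  | succ k _ ih => exact ih.succ hΨ hUm hU0 hU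

theorem exists_minorizedOn_univ [IsProbabilityMeasure μ] [TopologicalSpace S] [CompactSpace S]
    (hΨ : Measurable fun p : M × S => Ψ p.1 p.2) (hUm : MeasurableSet U) (hU0 : ν U ≠ 0)
    (hU : ∀ y ∈ U, ∀ h : S → ℝ≥0∞, Measurable h → ∫⁻ z, h z ∂ν ≤ lintegralTransfer μ Ψ h y)
    (hloc : ∀ y, ∃ V ∈ 𝓝 y, ∃ n, MinorizedOn μ Ψ ν n V) :
    ∃ n, MinorizedOn μ Ψ ν n Set.univ := by
  refine isCompact_univ.induction_on (p := fun V => ∃ n, MinorizedOn μ Ψ ν n V)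
    ⟨0, 1, one_ne_zero, fun y hy => hy.elim⟩ ?_ ?_ ?_
  · rintro s t hst ⟨n, h⟩
    exact ⟨n, h.mono hst⟩
  · rintro s t ⟨n, hs⟩ ⟨k, ht⟩
    exact ⟨max n k, (hs.le hΨ hUm hU0 hU (le_max_left _ _)).union
      (ht.le hΨ hUm hU0 hU (le_max_right _ _))⟩
  · intro y _
    obtain ⟨V, hV, h⟩ := hloc y
    exact ⟨V, mem_nhdsWithin_of_mem_nhds hV, h⟩

theorem exists_poisson_solution_of_minorizedOn_univ [IsProbabilityMeasure μ]
    (hΨ : Measurable fun p : M × S => Ψ p.1 p.2) [IsFiniteMeasure ν] (hν : ν ≠ 0)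
    (hmin : MinorizedOn μ Ψ ν n Set.univ) {f : S → ℝ} (hf : BoundedMeasurable f) :
    ∃ (lam : ℝ) (g : S → ℝ), BoundedMeasurable g ∧ ∀ y, f y = lam + g y - transfer μ Ψ g y := by
  obtain ⟨c, hc, h⟩ := hmin
  -- The constant is capped at `1` so that the minorizing measure is finite.
  have hc1 : min c 1 ≠ ⊤ := ne_top_of_le_ne_top ENNReal.one_ne_top (min_le_right _ _)
  have hc0 : min c 1 ≠ 0 := (lt_min (pos_iff_ne_zero.2 hc) one_pos).ne'
  have hfin : IsFiniteMeasure (min c 1 • ν) := ν.smul_finite hc1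
  have hne : NeZero (min c 1 • ν) := by
    refine ⟨fun h0 => hν ?_⟩
    have h1 := congrArg (fun m : Measure S => m Set.univ) h0
    simp only [Measure.smul_apply, smul_eq_mul, Measure.coe_zero, Pi.zero_apply, mul_eq_zero,
      hc0, false_or] at h1
    exact Measure.measure_univ_eq_zero.1 h1
  refine exists_poisson_solution (ν := min c 1 • ν) (n := n) hΨ (fun y φ hφ => ?_) hf
  rw [lintegral_smul_measure, smul_eq_mul]
  exact le_trans (by gcongr; exact min_le_left _ _) (h y trivial φ hφ)

end

/-- A property that, from each fixed state, holds almost surely for the next step holds almost surely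
at all steps along an orbit. -/
theorem ae_forall_orbit {M S : Type*} [MeasurableSpace M] [MeasurableSpace S] {μ : Measure M}
    [IsProbabilityMeasure μ] {Ψ : M → S → S} (hΨ : Measurable fun p : M × S => Ψ p.1 p.2)
    {p : M → S → Prop} (hp : MeasurableSet {q : M × S | p q.1 q.2})
    (h : ∀ y, ∀ᵐ w ∂μ, p w y) (y : S) :
    ∀ᵐ ω ∂(Measure.infinitePi fun _ : ℕ => μ), ∀ n, p (ω n) (orbit Ψ y ω n) := by
  refine ae_all_iff.2 fun n => ?_
  have hset : ∀ n y, MeasurableSet {ω : ℕ → M | p (ω n) (orbit Ψ y ω n)} := fun n y =>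
    hp.preimage ((measurable_pi_apply n).prodMk (measurable_orbit_right hΨ y n))
  induction n generalizing y with
  | zero =>
    have h1 := (measurePreserving_eval_infinitePi (fun _ : ℕ => μ) 0).quasiMeasurePreserving.ae (h y)
    exact h1
  | succ n ih =>
    rw [← map_seqCons μ, ae_map_iff measurable_seqCons.aemeasurable (hset _ _)]
    refine (Measure.ae_prod_iff_ae_ae (measurable_seqCons (hset (n + 1) y))).2
      (ae_of_all _ fun w => ?_)
    change ∀ᵐ ω ∂(Measure.infinitePi fun _ : ℕ => μ),
      p (seqCons w ω (n + 1)) (orbit Ψ y (seqCons w ω) (n + 1))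
    simp only [orbit_seqCons]
    exact ih (Ψ w y)

end RandomIteration

namespace LeakyReLUNet

open RandomIteration
open scoped NNReal

/-! ### Weight distributions that dominate a rotation-invariant measure -/

theorem smul_restrict_le_withDensity {X : Type*} [MeasurableSpace X] {m : Measure X} {B : Set X}
    (hB : MeasurableSet B) {f : X → ℝ≥0∞} {c : ℝ≥0∞} (h : ∀ᵐ x ∂m, x ∈ B → c ≤ f x) :
    c • m.restrict B ≤ m.withDensity f := by
  rw [← withDensity_const, ← withDensity_indicator hB]
  refine withDensity_mono ?_
  filter_upwards [h] with x hx
  by_cases hxB : x ∈ B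
  · simpa [hxB] using hx hxB
  · simp [hxB]

theorem measure_pi_mono {ι : Type*} [Fintype ι] {X : ι → Type*} [∀ i, MeasurableSpace (X i)]
    {ν μ : ∀ i, Measure (X i)} [∀ i, SigmaFinite (ν i)] (h : ∀ i, ν i ≤ μ i) :
    Measure.pi ν ≤ Measure.pi μ := by
  refine Measure.le_iff.2 fun s hs => ?_
  rw [Measure.pi, Measure.pi, toMeasure_apply _ _ hs, toMeasure_apply _ _ hs]
  have key : OuterMeasure.pi (fun i => (ν i).toOuterMeasure) ≤
      OuterMeasure.pi fun i => (μ i).toOuterMeasure := by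
    refine OuterMeasure.le_pi.2 fun t ht => ?_
    exact (OuterMeasure.pi_pi_le _ _).trans (Finset.prod_le_prod' fun i _ => h i (t i))
  exact key s

theorem smul_restrict_pi_le_pi {ι : Type*} [Fintype ι] {X : ι → Type*}
    [∀ i, MeasurableSpace (X i)] {ν μ : ∀ i, Measure (X i)} [∀ i, SigmaFinite (ν i)]
    {s : ∀ i, Set (X i)} {c : ι → ℝ≥0} (h : ∀ i, c i • (ν i).restrict (s i) ≤ μ i) :
    (∏ i, c i) • (Measure.pi ν).restrict (Set.univ.pi s) ≤ Measure.pi μ := by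
  refine le_trans (le_of_eq ?_) (measure_pi_mono h)
  rw [Measure.restrict_pi_pi]
  refine (Measure.pi_eq fun t _ => ?_).symm
  simp only [Measure.smul_apply, Measure.pi_pi, ENNReal.smul_def, smul_eq_mul,
    Finset.prod_mul_distrib, ENNReal.ofNNReal_finsetProd]

/-- Near the scalar matrix `η • 1`, the distribution `μ` dominates a positive multiple of a measure
`m` that is invariant under right multiplication by orthogonal matrices and that charges all
neighbourhoods of the points of `η • O(d)`. Independent entries with densities and densities on
`η • O(d)` both lead to this situation, with `m` the Lebesgue measure and the Haar measure. -/
structure IsLocallySpread {d : ℕ} (μ m : Measure (Matrix (Fin d) (Fin d) ℝ)) (η : ℝ) (c : ℝ≥0)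
    (B : Set (Matrix (Fin d) (Fin d) ℝ)) : Prop where
  scale_pos : 0 < η
  const_ne_zero : c ≠ 0
  map_mul_right : ∀ R ∈ Matrix.orthogonalGroup (Fin d) ℝ, m.map (fun W => W * R) = m
  measure_ne_zero : ∀ Q ∈ Matrix.orthogonalGroup (Fin d) ℝ, ∀ U ∈ 𝓝 (η • Q), m U ≠ 0
  mem_nhds : B ∈ 𝓝 (η • (1 : Matrix (Fin d) (Fin d) ℝ))
  measurableSet : MeasurableSet B
  measure_ne_top : m B ≠ ⊤
  smul_restrict_le : c • m.restrict B ≤ μ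

/-- The distribution of a matrix with independent entries is the iterated product of the distributions
of the entries. -/
theorem eq_pi_of_iIndepFun {d : ℕ} {μ : Measure (Matrix (Fin d) (Fin d) ℝ)}
    [IsProbabilityMeasure μ]
    (h : iIndepFun (fun (ij : Fin d × Fin d) (W : Matrix (Fin d) (Fin d) ℝ) => W ij.1 ij.2) μ) :
    μ = (Measure.pi fun i => Measure.pi fun j => μ.map fun W => W i j :
      Measure (Fin d → Fin d → ℝ)) := by
  have hm : ∀ ij : Fin d × Fin d,
      Measurable fun W : Matrix (Fin d) (Fin d) ℝ => W ij.1 ij.2 := fun ij =>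
    (measurable_pi_apply ij.2).comp (measurable_pi_apply ij.1)
  have hp : ∀ i j, IsProbabilityMeasure (μ.map fun W => W i j) := fun i j =>
    Measure.isProbabilityMeasure_map (hm (i, j)).aemeasurable
  have h1 := h.map_fun_eq_infinitePi_map hm
  have h2 := Measure.infinitePi_map_curry fun i j => μ.map fun W => W i j
  rw [← h1, Measure.map_map (MeasurableEquiv.measurable _) (measurable_pi_lambda _ hm)] at h2
  simp only [Measure.infinitePi_eq_pi] at h2
  rw [← h2]
  exact Measure.map_id.symm

theorem map_mul_right_volume {d : ℕ} {R : Matrix (Fin d) (Fin d) ℝ}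
    (hR : R ∈ Matrix.orthogonalGroup (Fin d) ℝ) :
    Measure.map (fun W : Matrix (Fin d) (Fin d) ℝ => W * R)
      (volume : Measure (Fin d → Fin d → ℝ)) = (volume : Measure (Fin d → Fin d → ℝ)) := by
  have hdet : |(Rᵀ).det| = 1 := by
    have h := congrArg Matrix.det ((Matrix.mem_orthogonalGroup_iff (Fin d) ℝ).1 hR)
    rw [Matrix.det_mul, Matrix.det_transpose, Matrix.det_one] at h
    rw [Matrix.det_transpose]
    exact (abs_eq zero_le_one).2 (mul_self_eq_one_iff.1 h)
  have h0 : (Rᵀ).det ≠ 0 := fun h => by simp [h] at hdet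
  have h1 : MeasurePreserving (Matrix.toLin' Rᵀ) (volume : Measure (Fin d → ℝ)) volume := by
    refine ⟨(LinearMap.continuous_of_finiteDimensional _).measurable, ?_⟩
    rw [Real.map_matrix_volume_pi_eq_smul_volume_pi h0, abs_inv, hdet]
    simp
  have h2 := volume_preserving_pi (ι := Fin d) (f := fun _ => Matrix.toLin' Rᵀ) fun _ => h1
  refine Eq.trans ?_ h2.map_eq
  refine congrArg (fun f => Measure.map f (volume : Measure (Fin d → Fin d → ℝ))) ?_
  funext W
  ext i j
  simp [Matrix.mul_apply, Matrix.mulVec, dotProduct, mul_comm]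

/-- For independent entries `m` is the Lebesgue measure on matrices and `η = 1`. -/
theorem HasIndependentEntryDensities.exists_isLocallySpread {d : ℕ}
    {μ : Measure (Matrix (Fin d) (Fin d) ℝ)} [IsProbabilityMeasure μ]
    {p : Fin d → Fin d → ℝ → ℝ} (h : HasIndependentEntryDensities μ p) :
    ∃ m η c B, IsLocallySpread μ m η c B := by
  obtain ⟨ε, hε, hpos⟩ := h.locallyPositive
  choose c hc hle using hpos
  set I : Fin d → Fin d → Set ℝ := fun i j =>
    Set.Icc ((1 : Matrix (Fin d) (Fin d) ℝ) i j - ε) ((1 : Matrix (Fin d) (Fin d) ℝ) i j + ε)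
  set B : Set (Fin d → Fin d → ℝ) := Set.univ.pi fun i => Set.univ.pi fun j => I i j
  have h1 : ∀ i j, (c i j).toNNReal • (volume : Measure ℝ).restrict (I i j) ≤
      μ.map fun W => W i j := by
    intro i j
    rw [h.density i j]
    refine smul_restrict_le_withDensity (c := ((c i j).toNNReal : ℝ≥0∞)) measurableSet_Icc
      (ae_of_all _ fun u hu => ENNReal.ofReal_le_ofReal ?_)
    have := hle i j (u - (1 : Matrix (Fin d) (Fin d) ℝ) i j)
      (abs_le.2 ⟨by linarith [hu.1], by linarith [hu.2]⟩)
    simpa using this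
  have h2 := smul_restrict_pi_le_pi fun i => smul_restrict_pi_le_pi (h1 i)
  rw [← eq_pi_of_iIndepFun h.indep] at h2
  refine ⟨(volume : Measure (Fin d → Fin d → ℝ)), 1, ∏ i, ∏ j, (c i j).toNNReal, B, ?_⟩
  refine ⟨one_pos, ?_, fun R hR => map_mul_right_volume hR, ?_, ?_, ?_, ?_, h2⟩
  · exact Finset.prod_ne_zero_iff.2 fun i _ => Finset.prod_ne_zero_iff.2 fun j _ =>
      (Real.toNNReal_pos.2 (hc i j)).ne'
  · intro Q _ U hU
    have key : ∀ (W : Fin d → Fin d → ℝ), ∀ V ∈ 𝓝 W, volume V ≠ 0 := fun W V hV =>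
      (MeasureTheory.Measure.measure_pos_of_mem_nhds volume hV).ne'
    exact key _ U hU
  · rw [one_smul]
    refine set_pi_mem_nhds Set.finite_univ fun i _ => set_pi_mem_nhds Set.finite_univ fun j _ => ?_
    exact Icc_mem_nhds (by linarith) (by linarith)
  · exact MeasurableSet.univ_pi fun i => MeasurableSet.univ_pi fun j => measurableSet_Icc
  · have : IsCompact B := isCompact_univ_pi fun i => isCompact_univ_pi fun j => isCompact_Icc
    exact this.measure_ne_top

theorem measurable_smul_coe {d : ℕ} (η : ℝ) :
    Measurable fun Q : Matrix.orthogonalGroup (Fin d) ℝ =>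
      η • (Q : Matrix (Fin d) (Fin d) ℝ) :=
  (continuous_subtype_val.const_smul η).measurable

instance isHaarMeasure_haarOrthogonal (d : ℕ) : (haarOrthogonal d).IsHaarMeasure :=
  Measure.isHaarMeasure_haarMeasure _

instance isProbabilityMeasure_haarOrthogonal (d : ℕ) : IsProbabilityMeasure (haarOrthogonal d) :=
  ⟨Measure.haarMeasure_self (K₀ := ⊤)⟩

theorem map_mul_right_haarOrthogonal {d : ℕ} (R : Matrix.orthogonalGroup (Fin d) ℝ) :
    (haarOrthogonal d).map (fun Q => Q * R) = haarOrthogonal d := by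
  have : IsProbabilityMeasure ((haarOrthogonal d).map fun Q => Q * R) :=
    Measure.isProbabilityMeasure_map (continuous_mul_const R).measurable.aemeasurable
  exact Measure.isHaarMeasure_eq_of_isProbabilityMeasure _ _

theorem continuous_opNorm {d : ℕ} : Continuous (opNorm (d := d)) :=
  continuous_norm.comp (LinearMap.continuous_of_finiteDimensional
    (Matrix.toEuclideanCLM (n := Fin d) (𝕜 := ℝ)).toAlgEquiv.toLinearMap)

theorem HasScaledOrthogonalDensity.exists_isLocallySpread {d : ℕ}
    {μ : Measure (Matrix (Fin d) (Fin d) ℝ)} {η : ℝ} {p : Matrix (Fin d) (Fin d) ℝ → ℝ}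
    (h : HasScaledOrthogonalDensity μ η p) :
    ∃ m η c B, IsLocallySpread μ m η c B := by
  obtain ⟨ε, hε, c, hc, hle⟩ := h.locallyPositive
  have hη := h.scale_pos
  set f : Matrix (Fin d) (Fin d) ℝ → ℝ := fun W => opNorm (η⁻¹ • W - 1) with hf
  have hcont : Continuous f := continuous_opNorm.comp ((continuous_id.const_smul η⁻¹).sub continuous_const)
  have hBm : MeasurableSet {W | f W ≤ ε} := (isClosed_le hcont continuous_const).measurableSet
  have : IsProbabilityMeasure (haarScaledOrthogonal d η) :=
    Measure.isProbabilityMeasure_map (measurable_smul_coe η).aemeasurable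
  refine ⟨haarScaledOrthogonal d η, η, c.toNNReal, {W | f W ≤ ε}, hη,
    (Real.toNNReal_pos.2 hc).ne', ?_, ?_, ?_, hBm, measure_ne_top _ _, ?_⟩
  · intro R hR
    have hmul : Measurable fun W : Matrix (Fin d) (Fin d) ℝ => W * R :=
      (continuous_mul_const R).measurable
    rw [haarScaledOrthogonal, Measure.map_map hmul (measurable_smul_coe η)]
    conv_rhs => rw [← map_mul_right_haarOrthogonal ⟨R, hR⟩]
    rw [Measure.map_map (measurable_smul_coe η) (continuous_mul_const _).measurable]
    congr 1
    ext Q : 1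
    simp
  · intro Q hQ U hU
    obtain ⟨V, hVU, hV, hQV⟩ := mem_nhds_iff.1 hU
    refine ne_of_gt (lt_of_lt_of_le ?_ (measure_mono hVU))
    rw [haarScaledOrthogonal, Measure.map_apply (measurable_smul_coe η) hV.measurableSet]
    exact (hV.preimage (continuous_subtype_val.const_smul η)).measure_pos _ ⟨⟨Q, hQ⟩, hQV⟩
  · have h0 : f (η • 1) = 0 := by
      simp [hf, opNorm, smul_smul, hη.ne']
    exact hcont.continuousAt.preimage_mem_nhds (Iic_mem_nhds (by rw [h0]; exact hε))
  · conv_rhs => rw [h.density]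
    refine smul_restrict_le_withDensity (c := (c.toNNReal : ℝ≥0∞)) hBm ?_
    rw [haarScaledOrthogonal, ae_map_iff (measurable_smul_coe η).aemeasurable]
    · refine ae_of_all _ fun Q hQ => ENNReal.ofReal_le_ofReal (hle Q Q.2 ?_)
      simpa [hf, smul_smul, hη.ne'] using hQ
    · have hm : Measurable fun W => ENNReal.ofReal (p W) := h.measurable.ennreal_ofReal
      exact MeasurableSet.imp hBm (measurableSet_le measurable_const hm)

/-! ### Second moment of the logarithm of `‖W y‖` -/

/-- `|v| ^ (-1/2)`, with the value `⊤` at `v = 0`. -/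
def invSqrtAbs (v : ℝ) : ℝ≥0∞ := ENNReal.ofReal |v| ^ (-(1 / 2) : ℝ)

theorem measurable_invSqrtAbs : Measurable invSqrtAbs :=
  (measurable_norm.ennreal_ofReal).pow_const _

theorem setLIntegral_invSqrtAbs_Ioc : ∫⁻ v in Set.Ioc 0 1, invSqrtAbs v ≠ ⊤ := by
  have h := (intervalIntegral.intervalIntegrable_rpow' (a := 0) (b := 1)
    (r := (-(1 / 2) : ℝ)) (by norm_num)).1
  have h2 := h.hasFiniteIntegral
  rw [hasFiniteIntegral_iff_norm] at h2
  refine ne_top_of_le_ne_top h2.ne (setLIntegral_mono' measurableSet_Ioc fun v hv => ?_)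
  have hv0 : 0 < v := hv.1
  rw [invSqrtAbs, abs_of_pos hv0, ENNReal.ofReal_rpow_of_pos hv0, Real.norm_eq_abs]
  exact ENNReal.ofReal_le_ofReal (le_abs_self _)

theorem setLIntegral_invSqrtAbs : ∫⁻ v in Set.Icc (-1) 1, invSqrtAbs v ≠ ⊤ := by
  have h1 : ∫⁻ v in Set.Icc 0 1, invSqrtAbs v ≠ ⊤ := by
    rw [setLIntegral_congr Ioc_ae_eq_Icc.symm]
    exact setLIntegral_invSqrtAbs_Ioc
  have h2 : ∫⁻ v in Set.Icc (-1) 0, invSqrtAbs v ≠ ⊤ := by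
    have h := (Measure.measurePreserving_neg (volume : Measure ℝ)).setLIntegral_comp_preimage
      (measurableSet_Icc (a := 0) (b := 1)) measurable_invSqrtAbs
    have hset : (Neg.neg : ℝ → ℝ) ⁻¹' Set.Icc 0 1 = Set.Icc (-1) 0 := by
      ext v
      simp only [Set.mem_preimage, Set.mem_Icc]
      constructor <;> rintro ⟨h1, h2⟩ <;> constructor <;> linarith
    have hneg : ∀ v, invSqrtAbs (-v) = invSqrtAbs v := fun v => by simp [invSqrtAbs]
    rw [hset] at h
    simp only [hneg] at h
    rwa [h]
  have hle := lintegral_union_le (μ := volume) invSqrtAbs (Set.Icc (-1) 0) (Set.Icc 0 1)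
  rw [Set.Icc_union_Icc_eq_Icc (by norm_num) zero_le_one] at hle
  exact ne_top_of_le_ne_top (ENNReal.add_ne_top.2 ⟨h2, h1⟩) hle

/-- A bound, uniform in `t`, for the expectation of `|t + u a| ^ (-1/2)` under a law with bounded
density. -/
theorem lintegral_invSqrtAbs_affine_le {p : ℝ → ℝ} {K : ℝ} (hK : ∀ u, |p u| ≤ K)
    {ρ : Measure ℝ} [IsProbabilityMeasure ρ]
    (hρ : ρ = volume.withDensity fun u => ENNReal.ofReal (p u)) {a : ℝ} (ha : a ≠ 0) (t : ℝ) :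
    ∫⁻ u, invSqrtAbs (t + u * a) ∂ρ ≤
      1 + ENNReal.ofReal K * (ENNReal.ofReal |a⁻¹| * ∫⁻ v in Set.Icc (-1) 1, invSqrtAbs v) := by
  set J : ℝ → ℝ≥0∞ := (Set.Icc (-1) 1).indicator invSqrtAbs with hJ
  have hJm : Measurable J := measurable_invSqrtAbs.indicator measurableSet_Icc
  have hle : ∀ v, invSqrtAbs v ≤ 1 + J v := by
    intro v
    by_cases hv : v ∈ Set.Icc (-1 : ℝ) 1
    · rw [hJ, Set.indicator_of_mem hv]
      exact le_add_self
    · have h1 : 1 ≤ |v| := by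
        by_contra hlt
        exact hv ⟨(abs_lt.1 (not_le.1 hlt)).1.le, (abs_lt.1 (not_le.1 hlt)).2.le⟩
      refine le_add_right ?_
      rw [invSqrtAbs]
      exact ENNReal.rpow_le_one_of_one_le_of_neg (ENNReal.one_le_ofReal.2 h1) (by norm_num)
  have hdom : ρ ≤ ENNReal.ofReal K • (volume : Measure ℝ) := by
    rw [hρ, ← withDensity_const]
    exact withDensity_mono (ae_of_all _ fun u =>
      ENNReal.ofReal_le_ofReal ((le_abs_self _).trans (hK u)))
  calc ∫⁻ u, invSqrtAbs (t + u * a) ∂ρ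
      ≤ ∫⁻ u, (1 + J (t + u * a)) ∂ρ := lintegral_mono fun u => hle _
    _ = 1 + ∫⁻ u, J (t + u * a) ∂ρ := by
        rw [lintegral_add_left measurable_const, lintegral_const, measure_univ, mul_one]
    _ ≤ 1 + ∫⁻ u, J (t + u * a) ∂(ENNReal.ofReal K • (volume : Measure ℝ)) := by
        gcongr
    _ = 1 + ENNReal.ofReal K * ∫⁻ u, J (t + u * a) := by
        rw [lintegral_smul_measure, smul_eq_mul]
    _ = _ := by
        congr 2
        have h1 : ∫⁻ u, J (t + u * a) =
            ∫⁻ v, J (t + v) ∂(Measure.map (fun u => u * a) volume) := by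
          exact (lintegral_map (f := fun v => J (t + v)) (hJm.comp (measurable_const_add t))
              (measurable_mul_const a)).symm
        rw [h1, Real.map_volume_mul_right ha, lintegral_smul_measure, smul_eq_mul,
          lintegral_add_left_eq_self J t, hJ, lintegral_indicator measurableSet_Icc]

/-- For large `r` the square of the logarithm is dominated by `r ^ 2`, for small `r` by a multiple of
`r ^ (-1/2)`, hence also with `r` replaced by a smaller `|v|`. -/
theorem ofReal_log_sq_le {r v : ℝ} (hv : |v| ≤ r) :
    ENNReal.ofReal (Real.log r ^ 2) ≤ ENNReal.ofReal (r ^ 2) + 16 * invSqrtAbs v := by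
  have hr : 0 ≤ r := (abs_nonneg v).trans hv
  rcases le_or_gt 1 r with h1 | h1
  · refine le_add_right (ENNReal.ofReal_le_ofReal ?_)
    have h2 := Real.log_nonneg h1
    have h3 := Real.log_le_sub_one_of_pos (zero_lt_one.trans_le h1)
    exact pow_le_pow_left₀ h2 (by linarith) 2
  · refine le_add_left ?_
    rcases (abs_nonneg v).eq_or_lt with h0 | h0
    · rw [invSqrtAbs, ← h0, ENNReal.ofReal_zero, ENNReal.zero_rpow_of_neg (by norm_num),
        ENNReal.mul_top (by norm_num)]
      exact le_top
    · have hr0 : 0 < r := h0.trans_le hv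
      have hs : 0 < r⁻¹ ^ (1 / 4 : ℝ) := by positivity
      have hlog : |Real.log r| ≤ 4 * r⁻¹ ^ (1 / 4 : ℝ) := by
        have h2 := Real.log_le_sub_one_of_pos hs
        rw [Real.log_rpow (inv_pos.2 hr0), Real.log_inv] at h2
        rw [abs_of_nonpos (Real.log_nonpos hr h1.le)]
        linarith
      have hsq : Real.log r ^ 2 ≤ 16 * r ^ (-(1 / 2) : ℝ) := by
        rw [← sq_abs]
        calc _ ≤ (4 * r⁻¹ ^ (1 / 4 : ℝ)) ^ 2 := pow_le_pow_left₀ (abs_nonneg _) hlog 2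
          _ = 16 * (r⁻¹ ^ (1 / 4 : ℝ)) ^ 2 := by ring
          _ = _ := by
            rw [← Real.rpow_natCast, ← Real.rpow_mul (inv_pos.2 hr0).le, Real.inv_rpow hr,
              ← Real.rpow_neg hr]
            norm_num
      have hmono : r ^ (-(1 / 2) : ℝ) ≤ |v| ^ (-(1 / 2) : ℝ) :=
        Real.rpow_le_rpow_of_nonpos h0 hv (by norm_num)
      rw [invSqrtAbs, ENNReal.ofReal_rpow_of_pos h0, show (16 : ℝ≥0∞) = ENNReal.ofReal 16 by simp,
        ← ENNReal.ofReal_mul (by norm_num)]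
      exact ENNReal.ofReal_le_ofReal (by linarith)

theorem norm_sq_toLp {d : ℕ} (v : Fin d → ℝ) : ‖WithLp.toLp 2 v‖ ^ 2 = ∑ i, v i ^ 2 := by
  rw [EuclideanSpace.norm_sq_eq]
  simp

theorem abs_apply_le_norm_toLp {d : ℕ} (v : Fin d → ℝ) (i : Fin d) :
    |v i| ≤ ‖WithLp.toLp 2 v‖ := by
  simpa using PiLp.norm_apply_le (WithLp.toLp 2 v) i

theorem measurable_entry {d : ℕ} (i j : Fin d) :
    Measurable fun W : Matrix (Fin d) (Fin d) ℝ => W i j :=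
  (measurable_pi_apply j).comp (measurable_pi_apply i)

/-- On the unit sphere, `W y` is almost surely nonzero and `log ‖W y‖` has a uniformly bounded second
moment. The first condition matters because `Real.log 0 = 0` would hide a vanishing `W y`. -/
def HasLogMoment {d : ℕ} (μ : Measure (Matrix (Fin d) (Fin d) ℝ)) : Prop :=
  ∃ C : ℝ≥0∞, C ≠ ⊤ ∧ ∀ y : EuclideanSpace ℝ (Fin d), ‖y‖ = 1 →
    (∀ᵐ W ∂μ, WithLp.toLp 2 (W *ᵥ y.ofLp) ≠ 0) ∧
    ∫⁻ W, ENNReal.ofReal (Real.log ‖WithLp.toLp 2 (W *ᵥ y.ofLp)‖ ^ 2) ∂μ ≤ C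

theorem norm_toLp_orthogonal_mulVec {d : ℕ} {Q : Matrix (Fin d) (Fin d) ℝ}
    (hQ : Q ∈ Matrix.orthogonalGroup (Fin d) ℝ) (y : EuclideanSpace ℝ (Fin d)) :
    ‖WithLp.toLp 2 (Q *ᵥ y.ofLp)‖ = ‖y‖ := by
  have h : ‖WithLp.toLp 2 (Q *ᵥ y.ofLp)‖ ^ 2 = ‖y‖ ^ 2 := by
    have hdot : ∀ v : Fin d → ℝ, ‖WithLp.toLp 2 v‖ ^ 2 = v ⬝ᵥ v := fun v => by
      rw [norm_sq_toLp]
      exact Finset.sum_congr rfl fun i _ => sq _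
    have hy := hdot y.ofLp
    rw [WithLp.toLp_ofLp] at hy
    rw [hdot, hy, Matrix.dotProduct_mulVec, Matrix.vecMul_mulVec]
    have := (Matrix.mem_orthogonalGroup_iff' (Fin d) ℝ).1 hQ
    change Qᵀ * Q = 1 at this
    rw [this]
    simp
  exact (sq_eq_sq₀ (norm_nonneg _) (norm_nonneg _)).1 h

theorem HasScaledOrthogonalDensity.hasLogMoment {d : ℕ}
    {μ : Measure (Matrix (Fin d) (Fin d) ℝ)} [IsProbabilityMeasure μ] {η : ℝ}
    {p : Matrix (Fin d) (Fin d) ℝ → ℝ} (h : HasScaledOrthogonalDensity μ η p) :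
    HasLogMoment μ := by
  have hη := h.scale_pos
  refine ⟨ENNReal.ofReal (Real.log η ^ 2), ENNReal.ofReal_ne_top, fun y hy => ?_⟩
  have hcont : Continuous fun W : Matrix (Fin d) (Fin d) ℝ =>
      ‖WithLp.toLp 2 (W *ᵥ y.ofLp)‖ := by
    have h1 : Continuous fun W : Matrix (Fin d) (Fin d) ℝ => W *ᵥ y.ofLp :=
      Continuous.matrix_mulVec continuous_id continuous_const
    exact ((PiLp.continuous_toLp 2 _).comp h1).norm
  have hae : ∀ᵐ W ∂μ, ‖WithLp.toLp 2 (W *ᵥ y.ofLp)‖ = η := by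
    have hac : μ ≪ haarScaledOrthogonal d η := by
      conv_lhs => rw [h.density]
      exact withDensity_absolutelyContinuous _ _
    suffices hm : ∀ᵐ W ∂(haarScaledOrthogonal d η), ‖WithLp.toLp 2 (W *ᵥ y.ofLp)‖ = η from
      hac.ae_le hm
    rw [haarScaledOrthogonal, ae_map_iff (measurable_smul_coe η).aemeasurable
      (measurableSet_eq_fun hcont.measurable measurable_const)]
    refine ae_of_all _ fun Q => ?_
    rw [Matrix.smul_mulVec, WithLp.toLp_smul, norm_smul, norm_toLp_orthogonal_mulVec Q.2, hy,
      mul_one, Real.norm_of_nonneg hη.le]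
  constructor
  · filter_upwards [hae] with W hW h0
    rw [h0, norm_zero] at hW
    exact hη.ne hW
  · rw [lintegral_congr_ae (g := fun _ => ENNReal.ofReal (Real.log η ^ 2))]
    · simp
    · filter_upwards [hae] with W hW
      rw [hW]

theorem exists_inv_le_abs_apply {d : ℕ} {y : EuclideanSpace ℝ (Fin d)} (hy : ‖y‖ = 1) :
    ∃ j, (d : ℝ)⁻¹ ≤ |y j| := by
  by_contra! hlt
  have h1 := EuclideanSpace.norm_sq_eq y
  rw [hy] at h1
  have hle : ∀ j, |y j| ≤ 1 := fun j => by
    have := PiLp.norm_apply_le y j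
    rwa [hy] at this
  rcases Nat.eq_zero_or_pos d with rfl | hd
  · simp at h1
  have : Nonempty (Fin d) := ⟨⟨0, hd⟩⟩
  have h2 : ∑ j, ‖y j‖ ^ 2 < ∑ _j : Fin d, (d : ℝ)⁻¹ := by
    refine Finset.sum_lt_sum_of_nonempty Finset.univ_nonempty fun j _ => ?_
    rw [Real.norm_eq_abs]
    nlinarith [hlt j, hle j, abs_nonneg (y j)]
  have hd' : (d : ℝ) ≠ 0 := by positivity
  simp [hd'] at h2
  simp at h1
  linarith

/-- Conditionally on the other entries of row `i`, the coordinate `(W y) i` is an affine function of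
`W i j`, which has a bounded density. -/
theorem HasIndependentEntryDensities.lintegral_invSqrtAbs_le {d : ℕ}
    {μ : Measure (Matrix (Fin d) (Fin d) ℝ)} [IsProbabilityMeasure μ]
    {p : Fin d → Fin d → ℝ → ℝ} (h : HasIndependentEntryDensities μ p) (i j : Fin d) {K : ℝ}
    (hK : ∀ u, |p i j u| ≤ K) (y : Fin d → ℝ) (hy : y j ≠ 0) :
    ∫⁻ W, invSqrtAbs ((W *ᵥ y) i) ∂μ ≤
      1 + ENNReal.ofReal K *
        (ENNReal.ofReal |(y j)⁻¹| * ∫⁻ v in Set.Icc (-1) 1, invSqrtAbs v) := by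
  classical
  have hX : ∀ k, Measurable fun W : Matrix (Fin d) (Fin d) ℝ => W i k * y k := fun k =>
    (measurable_entry i k).mul_const _
  have hind : iIndepFun (fun k (W : Matrix (Fin d) (Fin d) ℝ) => W i k * y k) μ := by
    have h1 := h.indep.precomp (g := fun k : Fin d => (i, k)) fun a b hab => (Prod.ext_iff.1 hab).2
    exact h1.comp (fun k u => u * y k) fun k => measurable_id.mul_const _
  set T : Matrix (Fin d) (Fin d) ℝ → ℝ := ∑ k ∈ Finset.univ.erase j, fun W => W i k * y k with hT
  have hTm : Measurable T := by
    have : T = fun W => ∑ k ∈ Finset.univ.erase j, W i k * y k := by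
      funext W
      rw [hT, Finset.sum_apply]
    rw [this]
    exact Finset.measurable_sum _ fun k _ => hX k
  have hTj : IndepFun T (fun W : Matrix (Fin d) (Fin d) ℝ => W i j * y j) μ :=
    hind.indepFun_finsetSum_of_notMem hX (Finset.notMem_erase j _)
  have hprod := (indepFun_iff_map_prod_eq_prod_map_map hTm.aemeasurable (hX j).aemeasurable).1 hTj
  have hsum : ∀ W : Matrix (Fin d) (Fin d) ℝ, (W *ᵥ y) i = T W + W i j * y j := by
    intro W
    rw [hT, Finset.sum_apply, Finset.sum_erase_add _ _ (Finset.mem_univ j)]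
    rfl
  have hprob : IsProbabilityMeasure (μ.map T) := Measure.isProbabilityMeasure_map hTm.aemeasurable
  have hprob' : IsProbabilityMeasure (μ.map fun W => W i j) :=
    Measure.isProbabilityMeasure_map (measurable_entry i j).aemeasurable
  have hprob'' : IsProbabilityMeasure (μ.map fun W => W i j * y j) :=
    Measure.isProbabilityMeasure_map (hX j).aemeasurable
  have hadd : Measurable fun q : ℝ × ℝ => invSqrtAbs (q.1 + q.2) :=
    measurable_invSqrtAbs.comp (measurable_fst.add measurable_snd)
  calc ∫⁻ W, invSqrtAbs ((W *ᵥ y) i) ∂μ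
      = ∫⁻ q, invSqrtAbs (q.1 + q.2) ∂(μ.map fun W => (T W, W i j * y j)) := by
        rw [lintegral_map hadd (hTm.prodMk (hX j))]
        simp only [hsum]
    _ = ∫⁻ t, ∫⁻ v, invSqrtAbs (t + v) ∂(μ.map fun W => W i j * y j) ∂(μ.map T) := by
        rw [hprod, lintegral_prod _ hadd.aemeasurable]
    _ = ∫⁻ t, ∫⁻ u, invSqrtAbs (t + u * y j) ∂(μ.map fun W => W i j) ∂(μ.map T) := by
        refine lintegral_congr fun t => ?_
        have hJt : Measurable fun v => invSqrtAbs (t + v) :=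
          measurable_invSqrtAbs.comp (measurable_const_add t)
        rw [lintegral_map hJt (hX j)]
        exact (lintegral_map (f := fun u => invSqrtAbs (t + u * y j))
          (hJt.comp (measurable_mul_const (y j))) (measurable_entry i j)).symm
    _ ≤ ∫⁻ _t, (1 + ENNReal.ofReal K *
        (ENNReal.ofReal |(y j)⁻¹| * ∫⁻ v in Set.Icc (-1) 1, invSqrtAbs v)) ∂(μ.map T) :=
        lintegral_mono fun t => lintegral_invSqrtAbs_affine_le hK (h.density i j) hy t
    _ = _ := by simp

theorem HasIndependentEntryDensities.lintegral_entry_sq_ne_top {d : ℕ}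
    {μ : Measure (Matrix (Fin d) (Fin d) ℝ)}
    {p : Fin d → Fin d → ℝ → ℝ} (h : HasIndependentEntryDensities μ p) (i j : Fin d) :
    ∫⁻ W, ENNReal.ofReal (W i j ^ 2) ∂μ ≠ ⊤ := by
  have hsq : Measurable fun u : ℝ => ENNReal.ofReal (u ^ 2) := by fun_prop
  have h1 : ∫⁻ W, ENNReal.ofReal (W i j ^ 2) ∂μ =
      ∫⁻ u, ENNReal.ofReal (u ^ 2) ∂(μ.map fun W => W i j) := by
    rw [lintegral_map hsq (measurable_entry i j)]
  rw [h1, h.density i j, lintegral_withDensity_eq_lintegral_mul _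
    (h.measurable i j).ennreal_ofReal hsq]
  have h2 := (h.secondMoment i j).hasFiniteIntegral
  rw [hasFiniteIntegral_iff_ofReal
    (ae_of_all _ fun u => mul_nonneg (sq_nonneg u) (h.nonneg i j u))] at h2
  refine ne_of_eq_of_ne (lintegral_congr fun u => ?_) h2.ne
  rw [Pi.mul_apply, mul_comm, ENNReal.ofReal_mul (sq_nonneg u)]

theorem norm_sq_mulVec_le {d : ℕ} (W : Matrix (Fin d) (Fin d) ℝ) {y : EuclideanSpace ℝ (Fin d)}
    (hy : ‖y‖ = 1) : ‖WithLp.toLp 2 (W *ᵥ y.ofLp)‖ ^ 2 ≤ ∑ i, ∑ j, W i j ^ 2 := by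
  rw [norm_sq_toLp]
  refine Finset.sum_le_sum fun i _ => ?_
  have h1 := Finset.sum_mul_sq_le_sq_mul_sq Finset.univ (fun j => W i j) y.ofLp
  have h2 : ∑ j, y.ofLp j ^ 2 = 1 := by
    have := norm_sq_toLp y.ofLp
    rw [WithLp.toLp_ofLp, hy] at this
    rw [← this]
    norm_num
  rw [h2, mul_one] at h1
  exact h1

theorem HasIndependentEntryDensities.hasLogMoment {d : ℕ} (hd : 1 ≤ d)
    {μ : Measure (Matrix (Fin d) (Fin d) ℝ)} [IsProbabilityMeasure μ]
    {p : Fin d → Fin d → ℝ → ℝ} (h : HasIndependentEntryDensities μ p) : HasLogMoment μ := by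
  -- A lower bound for one coordinate of `W y` suffices.
  set i₀ : Fin d := ⟨0, hd⟩
  choose K hK using h.bounded
  set J := ∫⁻ v in Set.Icc (-1) 1, invSqrtAbs v
  set A := ∑ j, (1 + ENNReal.ofReal (K i₀ j) * (ENNReal.ofReal d * J))
  set E := ∑ i, ∑ j, ∫⁻ W, ENNReal.ofReal (W i j ^ 2) ∂μ
  have hAtop : A ≠ ⊤ := ENNReal.sum_ne_top.2 fun j _ => ENNReal.add_ne_top.2
    ⟨ENNReal.one_ne_top, ENNReal.mul_ne_top ENNReal.ofReal_ne_top
      (ENNReal.mul_ne_top ENNReal.ofReal_ne_top setLIntegral_invSqrtAbs)⟩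
  have hEtop : E ≠ ⊤ := ENNReal.sum_ne_top.2 fun i _ => ENNReal.sum_ne_top.2 fun j _ =>
    h.lintegral_entry_sq_ne_top i j
  refine ⟨E + 16 * A, ENNReal.add_ne_top.2 ⟨hEtop, ENNReal.mul_ne_top (by norm_num) hAtop⟩,
    fun y hy => ?_⟩
  obtain ⟨j, hj⟩ := exists_inv_le_abs_apply hy
  have hd0 : (0 : ℝ) < (d : ℝ)⁻¹ := by
    have : (0 : ℝ) < d := by exact_mod_cast hd
    positivity
  have hyj : y.ofLp j ≠ 0 := fun h0 => by
    rw [h0, abs_zero] at hj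
    linarith
  have hmv : ∀ i, Measurable fun W : Matrix (Fin d) (Fin d) ℝ => (W *ᵥ y.ofLp) i := by
    intro i
    change Measurable fun W : Matrix (Fin d) (Fin d) ℝ => ∑ k, W i k * y.ofLp k
    exact Finset.measurable_sum _ fun k _ => (measurable_entry i k).mul_const _
  have hJm : Measurable fun W : Matrix (Fin d) (Fin d) ℝ => invSqrtAbs ((W *ᵥ y.ofLp) i₀) :=
    measurable_invSqrtAbs.comp (hmv i₀)
  have hJle : ∫⁻ W, invSqrtAbs ((W *ᵥ y.ofLp) i₀) ∂μ ≤ A := by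
    refine (h.lintegral_invSqrtAbs_le i₀ j (hK i₀ j) y.ofLp hyj).trans ?_
    refine le_trans ?_ (Finset.single_le_sum (f := fun j =>
      1 + ENNReal.ofReal (K i₀ j) * (ENNReal.ofReal d * J)) (fun _ _ => zero_le) (Finset.mem_univ j))
    have : |(y.ofLp j)⁻¹| ≤ d := by
      rw [abs_inv]
      exact inv_le_of_inv_le₀ (Nat.cast_pos.2 hd) hj
    gcongr
  constructor
  · filter_upwards [ae_lt_top hJm (ne_top_of_le_ne_top hAtop hJle)] with W hW h0
    have h1 : (W *ᵥ y.ofLp) i₀ = 0 := by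
      have := congrArg (fun v : EuclideanSpace ℝ (Fin d) => v.ofLp i₀) h0
      simpa using this
    rw [h1, invSqrtAbs, abs_zero, ENNReal.ofReal_zero, ENNReal.zero_rpow_of_neg (by norm_num)] at hW
    exact lt_irrefl _ hW
  · calc _ ≤ ∫⁻ W, ((∑ i, ∑ j, ENNReal.ofReal (W i j ^ 2)) +
          16 * invSqrtAbs ((W *ᵥ y.ofLp) i₀)) ∂μ := by
          refine lintegral_mono fun W => ?_
          refine (ofReal_log_sq_le (abs_apply_le_norm_toLp (W *ᵥ y.ofLp) i₀)).trans ?_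
          gcongr
          refine (ENNReal.ofReal_le_ofReal (norm_sq_mulVec_le W hy)).trans (le_of_eq ?_)
          exact (ENNReal.ofReal_sum_of_nonneg fun i _ =>
            Finset.sum_nonneg fun j _ => sq_nonneg _).trans (Finset.sum_congr rfl fun i _ =>
              ENNReal.ofReal_sum_of_nonneg fun j _ => sq_nonneg _)
      _ = E + 16 * ∫⁻ W, invSqrtAbs ((W *ᵥ y.ofLp) i₀) ∂μ := by
          have hm : ∀ i j, Measurable fun W : Matrix (Fin d) (Fin d) ℝ =>
              ENNReal.ofReal (W i j ^ 2) := fun i j =>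
            ((measurable_entry i j).pow_const 2).ennreal_ofReal
          rw [lintegral_add_right _ (hJm.const_mul _), lintegral_const_mul _ hJm,
            lintegral_finsetSum _ fun i _ => Finset.measurable_sum _ fun j _ => hm i j]
          congr 1
          exact Finset.sum_congr rfl fun i _ => lintegral_finsetSum _ fun j _ => hm i j
      _ ≤ _ := by gcongr

/-! ### Rotations carrying one unit vector to another -/

/-- The reflection in the hyperplane orthogonal to `w`; it is the identity for `w = 0`, by the
convention `2 / 0 = 0`. -/
def householder {d : ℕ} (w : Fin d → ℝ) : Matrix (Fin d) (Fin d) ℝ :=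
  1 - (2 / (w ⬝ᵥ w)) • Matrix.vecMulVec w w

theorem householder_mulVec {d : ℕ} (w v : Fin d → ℝ) :
    householder w *ᵥ v = v - (2 * (w ⬝ᵥ v) / (w ⬝ᵥ w)) • w := by
  rw [householder, Matrix.sub_mulVec, Matrix.one_mulVec, Matrix.smul_mulVec,
    Matrix.vecMulVec_mulVec]
  congr 1
  ext i
  simp
  ring

theorem householder_transpose {d : ℕ} (w : Fin d → ℝ) : (householder w)ᵀ = householder w := by
  rw [householder, Matrix.transpose_sub, Matrix.transpose_one, Matrix.transpose_smul,
    Matrix.transpose_vecMulVec]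

theorem householder_mem {d : ℕ} (w : Fin d → ℝ) :
    householder w ∈ Matrix.orthogonalGroup (Fin d) ℝ := by
  rw [Matrix.mem_orthogonalGroup_iff]
  change householder w * (householder w)ᵀ = 1
  rw [householder_transpose]
  refine Matrix.ext_of_mulVec_single fun i => ?_
  rw [← Matrix.mulVec_mulVec, householder_mulVec, householder_mulVec, Matrix.one_mulVec,
    dotProduct_sub, dotProduct_smul]
  by_cases hw : w ⬝ᵥ w = 0
  · simp [hw]
  · set v := Pi.single (M := fun _ => ℝ) i 1
    ext k
    simp only [Pi.sub_apply, Pi.smul_apply, smul_eq_mul]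
    field_simp
    ring

/-- For unit vectors `y` and `z`, an orthogonal matrix that carries `y` to `z` and tends to the identity
as `z → y`: the first reflection maps `y` to `-y`, the second maps `-y` to `z`. -/
def rotation {d : ℕ} (y z : Fin d → ℝ) : Matrix (Fin d) (Fin d) ℝ :=
  householder (y + z) * householder y

theorem rotation_mem {d : ℕ} (y z : Fin d → ℝ) :
    rotation y z ∈ Matrix.orthogonalGroup (Fin d) ℝ :=
  mul_mem (householder_mem _) (householder_mem _)

theorem rotation_mulVec {d : ℕ} {y z : Fin d → ℝ} (hy : y ⬝ᵥ y = 1) (hz : z ⬝ᵥ z = 1) :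
    rotation y z *ᵥ y = z := by
  have h1 : householder y *ᵥ y = -y := by
    rw [householder_mulVec, hy]
    ext i
    simp
    ring
  have hw : (y + z) ⬝ᵥ (y + z) = 2 * (1 + y ⬝ᵥ z) := by
    rw [dotProduct_add, add_dotProduct, add_dotProduct, hy, hz, dotProduct_comm z y]
    ring
  rw [rotation, ← Matrix.mulVec_mulVec, h1, householder_mulVec, hw, dotProduct_neg,
    add_dotProduct, hy, dotProduct_comm z y]
  by_cases h0 : 1 + y ⬝ᵥ z = 0
  · rw [h0, mul_zero, dotProduct_self_eq_zero] at hw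
    rw [h0]
    simpa using (eq_neg_of_add_eq_zero_right hw).symm
  · ext i
    simp only [Pi.sub_apply, Pi.smul_apply, Pi.neg_apply, Pi.add_apply, smul_eq_mul]
    field_simp
    ring

theorem rotation_self {d : ℕ} {y : Fin d → ℝ} (hy : y ⬝ᵥ y = 1) : rotation y y = 1 := by
  have h1 : householder (y + y) = householder y := by
    rw [householder, householder, dotProduct_add, add_dotProduct, hy]
    congr 1
    ext i j
    simp [Matrix.vecMulVec_apply]
    ring
  have h2 := (Matrix.mem_orthogonalGroup_iff (Fin d) ℝ).1 (householder_mem y)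
  change householder y * (householder y)ᵀ = 1 at h2
  rw [rotation, h1]
  rwa [householder_transpose] at h2

theorem continuousAt_rotation {d : ℕ} {y : Fin d → ℝ} (hy : y ⬝ᵥ y = 1) :
    ContinuousAt (rotation y) y := by
  have h0 : (y + y) ⬝ᵥ (y + y) ≠ 0 := by
    rw [dotProduct_add, add_dotProduct, hy]
    norm_num
  have hdot : Continuous fun z : Fin d → ℝ => (y + z) ⬝ᵥ (y + z) := by
    unfold dotProduct
    fun_prop
  have hvec : Continuous fun z : Fin d → ℝ => Matrix.vecMulVec (y + z) (y + z) :=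
    Continuous.matrix_vecMulVec (by fun_prop) (by fun_prop)
  unfold rotation householder
  refine ContinuousAt.mul (continuousAt_const.sub (ContinuousAt.fun_smul ?_ hvec.continuousAt))
    continuousAt_const
  exact continuousAt_const.div hdot.continuousAt h0

/-! ### The projected chain on the unit sphere -/

theorem le_leakyReLU (α x : ℝ) : x ≤ leakyReLU α x := le_max_left _ _

theorem mul_le_leakyReLU (α x : ℝ) : α * x ≤ leakyReLU α x := le_max_right _ _

theorem leakyReLU_mul (α : ℝ) {t : ℝ} (ht : 0 ≤ t) (x : ℝ) :
    leakyReLU α (t * x) = t * leakyReLU α x := by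
  rw [leakyReLU, leakyReLU, mul_max_of_nonneg _ _ ht]
  congr 1
  ring

theorem continuous_leakyReLU (α : ℝ) : Continuous (leakyReLU α) := by
  unfold leakyReLU
  fun_prop

theorem min_mul_abs_le_abs_leakyReLU (α x : ℝ) : min 1 |α| * |x| ≤ |leakyReLU α x| := by
  rcases max_choice x (α * x) with h | h
  · rw [leakyReLU, h]
    exact mul_le_of_le_one_left (abs_nonneg _) (min_le_left _ _)
  · rw [leakyReLU, h, abs_mul]
    gcongr
    exact min_le_right _ _

theorem abs_leakyReLU_le_max_mul_abs (α x : ℝ) : |leakyReLU α x| ≤ max 1 |α| * |x| := by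
  rcases max_choice x (α * x) with h | h
  · rw [leakyReLU, h]
    exact le_mul_of_one_le_left (abs_nonneg _) (le_max_left _ _)
  · rw [leakyReLU, h, abs_mul]
    gcongr
    exact le_max_right _ _

/-- The componentwise Leaky ReLU on Euclidean space. -/
def activate {d : ℕ} (α : ℝ) (x : EuclideanSpace ℝ (Fin d)) : EuclideanSpace ℝ (Fin d) :=
  WithLp.toLp 2 fun i => leakyReLU α (x i)

section activate

variable {d : ℕ} {α : ℝ}

theorem layer_eq_activate (W : Matrix (Fin d) (Fin d) ℝ) (x : EuclideanSpace ℝ (Fin d)) :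
    layer α W x = activate α (WithLp.toLp 2 (W *ᵥ x.ofLp)) := rfl

theorem activate_smul {t : ℝ} (ht : 0 ≤ t) (x : EuclideanSpace ℝ (Fin d)) :
    activate α (t • x) = t • activate α x := by
  ext i
  simp [activate, leakyReLU_mul α ht]

theorem continuous_activate : Continuous (activate (d := d) α) := by
  refine (PiLp.continuous_toLp 2 _).comp (continuous_pi fun i => ?_)
  exact (continuous_leakyReLU α).comp (EuclideanSpace.proj (𝕜 := ℝ) i).continuous

theorem norm_sq_eq_sum (x : EuclideanSpace ℝ (Fin d)) : ‖x‖ ^ 2 = ∑ i, x i ^ 2 :=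
  norm_sq_toLp x.ofLp

theorem min_mul_norm_le_norm_activate (x : EuclideanSpace ℝ (Fin d)) :
    min 1 |α| * ‖x‖ ≤ ‖activate α x‖ := by
  have hm : 0 ≤ min 1 |α| := le_min zero_le_one (abs_nonneg _)
  refine (sq_le_sq₀ (by positivity) (norm_nonneg _)).1 ?_
  rw [mul_pow, norm_sq_eq_sum, norm_sq_eq_sum, Finset.mul_sum]
  refine Finset.sum_le_sum fun i _ => ?_
  rw [← mul_pow, ← sq_abs, abs_mul, abs_of_nonneg hm, ← sq_abs (activate α x i)]
  exact pow_le_pow_left₀ (by positivity) (min_mul_abs_le_abs_leakyReLU α (x i)) 2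

theorem norm_activate_le_max_mul_norm (x : EuclideanSpace ℝ (Fin d)) :
    ‖activate α x‖ ≤ max 1 |α| * ‖x‖ := by
  have hm : 0 ≤ max 1 |α| := zero_le_one.trans (le_max_left _ _)
  refine (sq_le_sq₀ (norm_nonneg _) (by positivity)).1 ?_
  rw [mul_pow, norm_sq_eq_sum, norm_sq_eq_sum, Finset.mul_sum]
  refine Finset.sum_le_sum fun i _ => ?_
  rw [← mul_pow, ← sq_abs, ← sq_abs (_ * _), abs_mul, abs_of_nonneg hm]
  exact pow_le_pow_left₀ (abs_nonneg _) (abs_leakyReLU_le_max_mul_abs α (x i)) 2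

theorem activate_ne_zero (hα : α ≠ 0) {x : EuclideanSpace ℝ (Fin d)} (hx : x ≠ 0) :
    activate α x ≠ 0 := by
  have hm : 0 < min 1 |α| := lt_min zero_lt_one (abs_pos.2 hα)
  exact norm_pos_iff.1
    ((mul_pos hm (norm_pos_iff.2 hx)).trans_le (min_mul_norm_le_norm_activate x))

theorem activate_of_nonneg (hα : α < 0) {x : EuclideanSpace ℝ (Fin d)} (hx : ∀ i, 0 ≤ x i) :
    activate α x = x := by
  ext i
  exact max_eq_left ((mul_nonpos_of_nonpos_of_nonneg hα.le (hx i)).trans (hx i))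

theorem activate_nonneg (hα : α < 0) (x : EuclideanSpace ℝ (Fin d)) (i : Fin d) :
    0 ≤ activate α x i := by
  rcases le_total 0 (x i) with h | h
  · exact h.trans (le_leakyReLU α _)
  · exact (mul_nonneg_of_nonpos_of_nonpos hα.le h).trans (mul_le_leakyReLU α _)

theorem measurable_layer : Measurable fun p : Matrix (Fin d) (Fin d) ℝ ×
    EuclideanSpace ℝ (Fin d) => layer α p.1 p.2 := by
  refine (PiLp.continuous_toLp 2 _).measurable.comp (measurable_pi_lambda _ fun i => ?_)
  refine (continuous_leakyReLU α).measurable.comp ?_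
  change Measurable fun p : Matrix (Fin d) (Fin d) ℝ × EuclideanSpace ℝ (Fin d) =>
    ∑ k, p.1 i k * p.2.ofLp k
  refine Finset.measurable_sum _ fun k _ => ?_
  exact ((measurable_entry i k).comp measurable_fst).mul
    ((EuclideanSpace.proj (𝕜 := ℝ) k).continuous.measurable.comp measurable_snd)

theorem continuous_layer_left (x : EuclideanSpace ℝ (Fin d)) :
    Continuous fun W : Matrix (Fin d) (Fin d) ℝ => layer α W x :=
  continuous_activate.comp ((PiLp.continuous_toLp 2 _).comp
    (Continuous.matrix_mulVec continuous_id continuous_const))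

theorem layer_smul {t : ℝ} (ht : 0 ≤ t) (W : Matrix (Fin d) (Fin d) ℝ)
    (x : EuclideanSpace ℝ (Fin d)) : layer α W (t • x) = t • layer α W x := by
  rw [layer_eq_activate, layer_eq_activate, WithLp.ofLp_smul, Matrix.mulVec_smul,
    WithLp.toLp_smul, activate_smul ht]

end activate

/-- The Euclidean unit sphere of `ℝ^d`. -/
abbrev UnitSphere (d : ℕ) : Type := Metric.sphere (0 : EuclideanSpace ℝ (Fin d)) 1

section rotation

variable {d : ℕ}

theorem UnitSphere.coe_ne_zero (y : UnitSphere d) : (y : EuclideanSpace ℝ (Fin d)) ≠ 0 :=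
  ne_zero_of_mem_unit_sphere y

theorem UnitSphere.norm_coe (y : UnitSphere d) : ‖(y : EuclideanSpace ℝ (Fin d))‖ = 1 :=
  norm_eq_of_mem_sphere y

theorem dotProduct_self_unitSphere (y : UnitSphere d) :
    (y : EuclideanSpace ℝ (Fin d)).ofLp ⬝ᵥ (y : EuclideanSpace ℝ (Fin d)).ofLp = 1 := by
  have h := norm_sq_eq_sum (y : EuclideanSpace ℝ (Fin d))
  rw [y.norm_coe, one_pow] at h
  exact (Finset.sum_congr rfl fun i _ => (sq _).symm).trans h.symm

/-- `rotation` for points of the unit sphere. -/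
def sphereRotation (y z : UnitSphere d) : Matrix (Fin d) (Fin d) ℝ :=
  rotation (y : EuclideanSpace ℝ (Fin d)).ofLp (z : EuclideanSpace ℝ (Fin d)).ofLp

theorem sphereRotation_mem (y z : UnitSphere d) :
    sphereRotation y z ∈ Matrix.orthogonalGroup (Fin d) ℝ := rotation_mem _ _

theorem sphereRotation_mulVec (y z : UnitSphere d) :
    sphereRotation y z *ᵥ (y : EuclideanSpace ℝ (Fin d)).ofLp =
      (z : EuclideanSpace ℝ (Fin d)).ofLp :=
  rotation_mulVec (dotProduct_self_unitSphere y) (dotProduct_self_unitSphere z)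

theorem transpose_sphereRotation_mulVec (y z : UnitSphere d) :
    (sphereRotation y z)ᵀ *ᵥ (z : EuclideanSpace ℝ (Fin d)).ofLp =
      (y : EuclideanSpace ℝ (Fin d)).ofLp := by
  have h : (sphereRotation y z)ᵀ * sphereRotation y z = 1 :=
    (Matrix.mem_orthogonalGroup_iff' (Fin d) ℝ).1 (sphereRotation_mem y z)
  rw [← sphereRotation_mulVec y z, Matrix.mulVec_mulVec, h, Matrix.one_mulVec]

theorem tendsto_sphereRotation (y : UnitSphere d) :
    Tendsto (sphereRotation y) (𝓝 y) (𝓝 1) := by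
  have h := (continuousAt_rotation (dotProduct_self_unitSphere y)).tendsto
  rw [rotation_self (dotProduct_self_unitSphere y)] at h
  have hc : Continuous fun z : UnitSphere d => (z : EuclideanSpace ℝ (Fin d)).ofLp :=
    (PiLp.continuous_ofLp 2 _).comp continuous_subtype_val
  exact h.comp hc.continuousAt

end rotation

section direction

variable {d : ℕ} [NeZero d]

/-- The unit vector with equal positive coordinates. It spans a ray that the activation fixes for each
`α`. -/
def diagonalDirection (d : ℕ) [NeZero d] : UnitSphere d :=
  ⟨WithLp.toLp 2 fun _ => (Real.sqrt d)⁻¹, by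
    have hd : (0 : ℝ) < d := by exact_mod_cast Nat.pos_of_ne_zero (NeZero.ne d)
    rw [mem_sphere_zero_iff_norm, ← sq_eq_sq₀ (norm_nonneg _) zero_le_one, norm_sq_toLp]
    simp [Real.sq_sqrt hd.le, hd.ne']⟩

theorem diagonalDirection_apply (i : Fin d) :
    (diagonalDirection d : EuclideanSpace ℝ (Fin d)) i = (Real.sqrt d)⁻¹ := rfl

theorem inv_sqrt_pos : 0 < (Real.sqrt d)⁻¹ := by
  have hd : (0 : ℝ) < d := by exact_mod_cast Nat.pos_of_ne_zero (NeZero.ne d)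
  positivity

/-- The normalization `x / ‖x‖`, with the arbitrary value `diagonalDirection d` at `x = 0`. That this
value does not depend on further data makes `projLayer α W y` a function of `W y` alone. -/
def direction (x : EuclideanSpace ℝ (Fin d)) : UnitSphere d :=
  if h : x = 0 then diagonalDirection d
  else ⟨‖x‖⁻¹ • x, by
    rw [mem_sphere_zero_iff_norm, norm_smul, norm_inv, norm_norm,
      inv_mul_cancel₀ (norm_ne_zero_iff.2 h)]⟩

theorem coe_direction {x : EuclideanSpace ℝ (Fin d)} (hx : x ≠ 0) :
    (direction x : EuclideanSpace ℝ (Fin d)) = ‖x‖⁻¹ • x := by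
  rw [direction, dif_neg hx]

theorem norm_smul_direction {x : EuclideanSpace ℝ (Fin d)} (hx : x ≠ 0) :
    ‖x‖ • (direction x : EuclideanSpace ℝ (Fin d)) = x := by
  rw [coe_direction hx, smul_smul, mul_inv_cancel₀ (norm_ne_zero_iff.2 hx), one_smul]

theorem direction_smul {t : ℝ} (ht : 0 < t) (x : EuclideanSpace ℝ (Fin d)) :
    direction (t • x) = direction x := by
  by_cases hx : x = 0
  · simp [hx]
  · have h : t • x ≠ 0 := smul_ne_zero ht.ne' hx
    refine Subtype.ext ?_
    rw [coe_direction h, coe_direction hx, norm_smul, Real.norm_of_nonneg ht.le, smul_smul]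
    congr 1
    field_simp

theorem direction_coe (y : UnitSphere d) : direction (y : EuclideanSpace ℝ (Fin d)) = y := by
  refine Subtype.ext ?_
  rw [coe_direction y.coe_ne_zero, y.norm_coe, inv_one, one_smul]

theorem measurable_direction : Measurable (direction (d := d)) := by
  have h : Measurable fun x : EuclideanSpace ℝ (Fin d) => (direction x : EuclideanSpace ℝ (Fin d)) := by
    have : (fun x : EuclideanSpace ℝ (Fin d) => (direction x : EuclideanSpace ℝ (Fin d))) =
        fun x => if x = 0 then (diagonalDirection d : EuclideanSpace ℝ (Fin d))
          else ‖x‖⁻¹ • x := by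
      funext x
      split_ifs with hx
      · rw [direction, dif_pos hx]
      · exact coe_direction hx
    rw [this]
    exact Measurable.ite (measurableSet_singleton 0) measurable_const
      (measurable_norm.inv.smul measurable_id)
  exact (MeasurableEmbedding.subtype_coe
    Metric.isClosed_sphere.measurableSet).measurable_comp_iff.1 h

theorem continuousAt_direction {x : EuclideanSpace ℝ (Fin d)} (hx : x ≠ 0) :
    ContinuousAt direction x := by
  rw [Topology.IsInducing.subtypeVal.continuousAt_iff]
  have h : ContinuousAt (fun x : EuclideanSpace ℝ (Fin d) => ‖x‖⁻¹ • x) x :=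
    (continuousAt_id.norm.inv₀ (norm_ne_zero_iff.2 hx)).smul continuousAt_id
  refine h.congr ?_
  filter_upwards [isOpen_ne.mem_nhds hx] with z hz
  exact (coe_direction hz).symm

/-- One step of the projected chain: `y ↦ φ(W y) / ‖φ(W y)‖`. -/
def projLayer (α : ℝ) (W : Matrix (Fin d) (Fin d) ℝ) (y : UnitSphere d) : UnitSphere d :=
  direction (layer α W y)

theorem measurable_projLayer (α : ℝ) :
    Measurable fun p : Matrix (Fin d) (Fin d) ℝ × UnitSphere d => projLayer α p.1 p.2 :=
  measurable_direction.comp (measurable_layer.comp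
    (measurable_fst.prodMk (measurable_subtype_coe.comp measurable_snd)))

theorem projLayer_smul_sphereRotation {α η : ℝ} (hη : 0 < η) (y z : UnitSphere d) :
    projLayer α (η • sphereRotation y z) y = direction (activate α z) := by
  rw [projLayer, layer_eq_activate, Matrix.smul_mulVec, sphereRotation_mulVec, WithLp.toLp_smul,
    activate_smul hη.le, direction_smul hη]

end direction

section minorization

variable {d : ℕ} [NeZero d] {μ m : Measure (Matrix (Fin d) (Fin d) ℝ)} {η : ℝ} {c : ℝ≥0}
  {B : Set (Matrix (Fin d) (Fin d) ℝ)} {α : ℝ}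

/-- The law of the next step from `y`, for the weight matrix distributed according to the restriction
of `c • m` to `B`. -/
def localLaw (m : Measure (Matrix (Fin d) (Fin d) ℝ)) (c : ℝ≥0)
    (B : Set (Matrix (Fin d) (Fin d) ℝ)) (α : ℝ) (y : UnitSphere d) : Measure (UnitSphere d) :=
  (c • m.restrict B).map fun W => projLayer α W y

theorem measurable_projLayer_left (α : ℝ) (y : UnitSphere d) :
    Measurable fun W : Matrix (Fin d) (Fin d) ℝ => projLayer α W y :=
  (measurable_projLayer α).comp measurable_prodMk_right

/-- `localLaw` charges each neighbourhood of the image of `z`, as soon as the rotation from `y` to `z`,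
scaled by `η`, is interior to `B`. -/
theorem localLaw_ne_zero (hc : c ≠ 0) (hm : ∀ Q ∈ Matrix.orthogonalGroup (Fin d) ℝ,
      ∀ U ∈ 𝓝 (η • Q), m U ≠ 0) (hη : 0 < η) (hα : α ≠ 0) {y z : UnitSphere d}
    (hB : B ∈ 𝓝 (η • sphereRotation y z)) {U : Set (UnitSphere d)}
    (hU : U ∈ 𝓝 (direction (activate α z))) : localLaw m c B α y U ≠ 0 := by
  have hW : layer α (η • sphereRotation y z) y ≠ 0 := by
    rw [layer_eq_activate, Matrix.smul_mulVec, sphereRotation_mulVec, WithLp.toLp_smul,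
      activate_smul hη.le]
    exact smul_ne_zero hη.ne' (activate_ne_zero hα z.coe_ne_zero)
  have hcont : ContinuousAt (fun W => projLayer α W y) (η • sphereRotation y z) :=
    ContinuousAt.comp (f := fun W => layer α W (y : EuclideanSpace ℝ (Fin d)))
      (continuousAt_direction hW) (continuous_layer_left _).continuousAt
  rw [← projLayer_smul_sphereRotation (α := α) hη y z] at hU
  have hpre := inter_mem (hcont.preimage_mem_nhds hU) hB
  have h0 := hm _ (sphereRotation_mem y z) _ hpre
  refine ne_of_gt (lt_of_lt_of_le (pos_iff_ne_zero.2 ?_) (Measure.le_map_apply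
    (measurable_projLayer_left α y).aemeasurable U))
  rw [Measure.smul_apply, ENNReal.smul_def, smul_eq_mul]
  refine mul_ne_zero (ENNReal.coe_ne_zero.2 hc) ?_
  exact ne_of_gt (lt_of_lt_of_le (pos_iff_ne_zero.2 h0) (Measure.le_restrict_apply _ _))

/-- Local minorization: the transition laws from all points `y'` near `y` dominate `localLaw` at `y`.
The substitution `W ↦ W R`, with `R` a rotation near the identity that carries `y'` to `y`, preserves
`m` and changes `W y'` into `W y`. -/
theorem IsLocallySpread.exists_lintegral_localLaw_le (hs : IsLocallySpread μ m η c B) (α : ℝ)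
    (y : UnitSphere d) :
    ∃ B' ⊆ B, B' ∈ 𝓝 (η • (1 : Matrix (Fin d) (Fin d) ℝ)) ∧ ∃ V ∈ 𝓝 y, ∀ y' ∈ V,
      ∀ h : UnitSphere d → ℝ≥0∞, Measurable h →
        ∫⁻ z, h z ∂(localLaw m c B' α y) ≤ lintegralTransfer μ (projLayer α) h y' := by
  have hmul : Tendsto (fun q : Matrix (Fin d) (Fin d) ℝ × Matrix (Fin d) (Fin d) ℝ => q.1 * q.2)
      (𝓝 (η • 1) ×ˢ 𝓝 1) (𝓝 (η • 1)) := by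
    have h := (continuous_mul (M := Matrix (Fin d) (Fin d) ℝ)).tendsto (η • 1, 1)
    rwa [nhds_prod_eq, mul_one] at h
  obtain ⟨B₁, hB₁, N, hN, hBN⟩ := mem_prod_iff.1 (hmul hs.mem_nhds)
  have hB₁B : B₁ ⊆ B := by
    intro W hW
    have := hBN (Set.mk_mem_prod hW (mem_of_mem_nhds hN))
    simpa using this
  have hT : Tendsto (fun z => (sphereRotation y z)ᵀ) (𝓝 y) (𝓝 1) := by
    have h := (continuous_id.matrix_transpose
      (X := Matrix (Fin d) (Fin d) ℝ)).tendsto 1 |>.comp (tendsto_sphereRotation y)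
    rw [id, Matrix.transpose_one] at h
    exact h
  refine ⟨interior B₁, interior_subset.trans hB₁B, interior_mem_nhds.2 hB₁, _, hT hN,
    fun y' hy' h hh => ?_⟩
  set R := (sphereRotation y y')ᵀ with hR
  have hRN : R ∈ N := hy'
  have hRO : R ∈ Matrix.orthogonalGroup (Fin d) ℝ := by
    exact Unitary.star_mem (sphereRotation_mem y y')
  have hmeas : ∀ y : UnitSphere d,
      Measurable fun W : Matrix (Fin d) (Fin d) ℝ => h (projLayer α W y) := fun y =>
    hh.comp (measurable_projLayer_left α y)
  have hRm : Measurable fun W : Matrix (Fin d) (Fin d) ℝ => W * R :=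
    (continuous_mul_const R).measurable
  have hproj : ∀ W : Matrix (Fin d) (Fin d) ℝ, projLayer α (W * R) y' = projLayer α W y := by
    intro W
    rw [projLayer, projLayer, layer_eq_activate, layer_eq_activate, ← Matrix.mulVec_mulVec, hR,
      transpose_sphereRotation_mulVec]
  calc ∫⁻ z, h z ∂(localLaw m c (interior B₁) α y)
      = c * ∫⁻ W, (interior B₁).indicator (fun W => h (projLayer α W y)) W ∂m := by
        rw [localLaw, lintegral_map hh (measurable_projLayer_left α y), lintegral_smul_measure,
          lintegral_indicator isOpen_interior.measurableSet, ENNReal.smul_def, smul_eq_mul]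
    _ ≤ c * ∫⁻ W, B.indicator (fun W => h (projLayer α W y')) (W * R) ∂m := by
        gcongr with W
        by_cases hW : W ∈ interior B₁
        · have hWR : W * R ∈ B := hBN (Set.mk_mem_prod (interior_subset hW) hRN)
          rw [Set.indicator_of_mem hW, Set.indicator_of_mem hWR, hproj]
        · rw [Set.indicator_of_notMem hW]
          exact zero_le
    _ = c * ∫⁻ W, B.indicator (fun W => h (projLayer α W y')) W ∂m := by
        conv_rhs => rw [← hs.map_mul_right R hRO]
        rw [lintegral_map ((hmeas y').indicator hs.measurableSet) hRm]
    _ = ∫⁻ W, h (projLayer α W y') ∂(c • m.restrict B) := by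
        rw [lintegral_smul_measure, lintegral_indicator hs.measurableSet, ENNReal.smul_def,
          smul_eq_mul]
    _ ≤ _ := lintegral_mono' hs.smul_restrict_le le_rfl

end minorization

/-! ### Accessibility on the sphere -/

theorem connectedSpace_unitSphere {d : ℕ} (hd : 2 ≤ d) : ConnectedSpace (UnitSphere d) := by
  refine isConnected_iff_connectedSpace.1 (isConnected_sphere ?_ 0 zero_le_one)
  rw [← Module.finrank_eq_rank, finrank_euclideanSpace_fin]
  exact_mod_cast hd

section geometry

variable {d : ℕ} [NeZero d] {α : ℝ}

theorem inner_diagonalDirection (x : EuclideanSpace ℝ (Fin d)) :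
    inner ℝ (diagonalDirection d : EuclideanSpace ℝ (Fin d)) x = (Real.sqrt d)⁻¹ * ∑ i, x i := by
  rw [PiLp.inner_apply, Finset.mul_sum]
  exact Finset.sum_congr rfl fun i _ => by
    rw [diagonalDirection_apply]
    simp [mul_comm]

theorem direction_activate_diagonalDirection :
    direction (activate α (diagonalDirection d : EuclideanSpace ℝ (Fin d))) =
      diagonalDirection d := by
  have h : activate α (diagonalDirection d : EuclideanSpace ℝ (Fin d)) =
      max 1 α • (diagonalDirection d : EuclideanSpace ℝ (Fin d)) := by
    ext i
    change leakyReLU α (Real.sqrt d)⁻¹ = max 1 α * (Real.sqrt d)⁻¹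
    rw [leakyReLU, max_mul_of_nonneg _ _ inv_sqrt_pos.le, one_mul]
  rw [h, direction_smul (zero_lt_one.trans_le (le_max_left _ _)), direction_coe]

/-- For `α > 0` the normalized activation does not increase the angle to the diagonal direction. As
`φ(x) ≥ x` and `φ(x) ≥ α x`, the inner product grows at least by the factor `max 1 α` if it is
nonnegative, and at most by `min 1 α` in absolute value if it stays negative, while the norm changes
by a factor between `min 1 α` and `max 1 α`. -/
theorem inner_le_inner_direction_activate (hα : 0 < α) (z : UnitSphere d) :
    inner ℝ (diagonalDirection d : EuclideanSpace ℝ (Fin d)) (z : EuclideanSpace ℝ (Fin d)) ≤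
      inner ℝ (diagonalDirection d : EuclideanSpace ℝ (Fin d))
        (direction (activate α (z : EuclideanSpace ℝ (Fin d))) :
          EuclideanSpace ℝ (Fin d)) := by
  set u : EuclideanSpace ℝ (Fin d) := (diagonalDirection d).val with hu
  set v := activate α (z : EuclideanSpace ℝ (Fin d))
  set s := inner ℝ u (z : EuclideanSpace ℝ (Fin d)) with hs
  have hv0 : v ≠ 0 := activate_ne_zero hα.ne' z.coe_ne_zero
  have hnv : 0 < ‖v‖ := norm_pos_iff.2 hv0
  have h1 : s ≤ inner ℝ u v := by
    rw [hs, hu, inner_diagonalDirection, inner_diagonalDirection]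
    gcongr with i
    exact le_leakyReLU _ _
  have h2 : α * s ≤ inner ℝ u v := by
    rw [hs, hu, inner_diagonalDirection, inner_diagonalDirection, mul_left_comm, Finset.mul_sum]
    gcongr with i
    exact mul_le_leakyReLU _ _
  have h3 := min_mul_norm_le_norm_activate (α := α) (z : EuclideanSpace ℝ (Fin d))
  have h4 := norm_activate_le_max_mul_norm (α := α) (z : EuclideanSpace ℝ (Fin d))
  rw [z.norm_coe, mul_one, abs_of_pos hα] at h3 h4
  rw [coe_direction hv0, inner_smul_right, inv_mul_eq_div, le_div_iff₀ hnv]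
  rcases le_total 0 s with h0 | h0
  · calc s * ‖v‖ ≤ s * max 1 α := mul_le_mul_of_nonneg_left h4 h0
      _ ≤ _ := by
        rcases max_choice 1 α with h | h <;> rw [h] <;> linarith
  · calc s * ‖v‖ ≤ s * min 1 α := mul_le_mul_of_nonpos_left h3 h0
      _ ≤ _ := by
        rcases min_choice 1 α with h | h <;> rw [h] <;> linarith

/-- Unless `y = ±u`, there are points `z` arbitrarily close to `y`, on the arc from `y` to `u`, that
are strictly closer to `u`. -/
theorem exists_inner_lt_inner {u y : UnitSphere d} (hyu : y ≠ u)
    (hyu' : (y : EuclideanSpace ℝ (Fin d)) ≠ -u) {N : Set (UnitSphere d)} (hN : N ∈ 𝓝 y) :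
    ∃ z ∈ N, inner ℝ (u : EuclideanSpace ℝ (Fin d)) (y : EuclideanSpace ℝ (Fin d)) <
        inner ℝ (u : EuclideanSpace ℝ (Fin d)) (z : EuclideanSpace ℝ (Fin d)) ∧
      ∃ p q : ℝ, 0 ≤ p ∧ 0 ≤ q ∧ (z : EuclideanSpace ℝ (Fin d)) =
        p • (y : EuclideanSpace ℝ (Fin d)) + q • (u : EuclideanSpace ℝ (Fin d)) := by
  set U : EuclideanSpace ℝ (Fin d) := (u : EuclideanSpace ℝ (Fin d))
  set Y : EuclideanSpace ℝ (Fin d) := (y : EuclideanSpace ℝ (Fin d))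
  have hUn : ‖U‖ = 1 := u.norm_coe
  have hYn : ‖Y‖ = 1 := y.norm_coe
  set a := inner ℝ U Y with ha
  have ha1 : a < 1 := by
    refine (inner_lt_one_iff_real_of_norm_eq_one hUn hYn).2 fun h => hyu (Subtype.ext h.symm)
  have ha2 : -1 < a := by
    have h := (inner_lt_one_iff_real_of_norm_eq_one hUn (by rw [norm_neg, hYn] : ‖-Y‖ = 1)).2
      fun h => hyu' (by rw [h, neg_neg])
    rw [inner_neg_right] at h
    linarith
  -- The curve leaves `y` in the direction of the component of `u` orthogonal to `y`.
  set x : ℝ → EuclideanSpace ℝ (Fin d) := fun t => (1 - t * a) • Y + t • U with hx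
  have hxc : Continuous x := by fun_prop
  have hx0 : x 0 = Y := by simp [hx]
  have htend : Tendsto (fun t => direction (x t)) (𝓝[>] 0) (𝓝 y) := by
    have h1 : ContinuousAt direction (x 0) := continuousAt_direction (by rw [hx0]; exact y.coe_ne_zero)
    have h2 : Tendsto (fun t => direction (x t)) (𝓝 0) (𝓝 (direction (x 0))) :=
      h1.tendsto.comp hxc.continuousAt
    rw [hx0, direction_coe] at h2
    exact h2.mono_left nhdsWithin_le_nhds
  obtain ⟨t, htN, ht0, ht1⟩ : ∃ t, direction (x t) ∈ N ∧ 0 < t ∧ t < 1 := by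
    have h1 : (fun t => direction (x t)) ⁻¹' N ∈ 𝓝[>] (0 : ℝ) := htend hN
    have h2 : Set.Ioo (0 : ℝ) 1 ∈ 𝓝[>] (0 : ℝ) := Ioo_mem_nhdsGT one_pos
    obtain ⟨t, ht, ht'⟩ := (inter_mem h1 h2 |> Filter.nonempty_of_mem)
    exact ⟨t, ht, ht'.1, ht'.2⟩
  set b := 1 - a ^ 2 with hb
  have hb0 : 0 < b := by nlinarith
  have hUU : inner ℝ U U = 1 := by rw [real_inner_self_eq_norm_sq, hUn, one_pow]
  have hYY : inner ℝ Y Y = 1 := by rw [real_inner_self_eq_norm_sq, hYn, one_pow]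
  have hYU : inner ℝ Y U = a := real_inner_comm _ _
  have hin : inner ℝ U (x t) = a + t * b := by
    rw [hx]
    simp only [inner_add_right, inner_smul_right, hUU]
    rw [← ha, hb]
    ring
  have hnsq : ‖x t‖ ^ 2 = 1 + t ^ 2 * b := by
    rw [← real_inner_self_eq_norm_sq]
    have : inner ℝ (x t) (x t) = (1 - t * a) * inner ℝ Y (x t) + t * inner ℝ U (x t) := by
      conv_lhs => rw [hx]
      simp only [inner_add_left, real_inner_smul_left]
      rfl
    have hy' : inner ℝ Y (x t) = 1 := by
      rw [hx]
      simp only [inner_add_right, inner_smul_right, hYY, hYU]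
      ring
    rw [this, hin, hy', hb]
    ring
  have hn1 : 1 ≤ ‖x t‖ := by
    have : 0 ≤ t ^ 2 * b := by positivity
    nlinarith [norm_nonneg (x t)]
  have hn2 : ‖x t‖ ≤ 1 + t ^ 2 * b / 2 := by
    refine abs_le_of_sq_le_sq' ?_ (by positivity) |>.2
    rw [hnsq]
    nlinarith [sq_nonneg (t ^ 2 * b)]
  have hxt : x t ≠ 0 := norm_pos_iff.1 (by linarith)
  refine ⟨direction (x t), htN, ?_, (1 - t * a) / ‖x t‖, t / ‖x t‖, ?_, by positivity, ?_⟩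
  · rw [coe_direction hxt, inner_smul_right, hin, inv_mul_eq_div, lt_div_iff₀ (by linarith)]
    have htb : 0 < t * b := by positivity
    rcases le_total 0 a with h0 | h0
    · have h5 : a * (t ^ 2 * b / 2) < t * b := by
        have : a * t < 2 := by nlinarith
        nlinarith
      nlinarith [mul_le_mul_of_nonneg_left hn2 h0]
    · nlinarith [mul_le_mul_of_nonpos_left hn1 h0]
  · have : 0 ≤ 1 - t * a := by nlinarith
    positivity
  · rw [coe_direction hxt, hx]
    simp only [smul_add, smul_smul]
    rw [inv_mul_eq_div, inv_mul_eq_div]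

variable {G : Set (UnitSphere d)} (hG : IsOpen G) (hu : diagonalDirection d ∈ G)
  (hstep : ∀ y : UnitSphere d, (∃ᶠ z : UnitSphere d in 𝓝 y,
    direction (activate α (z : EuclideanSpace ℝ (Fin d))) ∈ G) → y ∈ G)
include hG hu hstep

/-- For `α > 0` and `d ≥ 2`, an open set `G` that contains the diagonal direction, and contains `y` as
soon as it contains the images of points arbitrarily close to `y`, is the whole sphere: a point
outside `G` that maximizes the inner product with the diagonal direction could be improved. -/
theorem eq_univ_of_pos (hα : 0 < α) (hd : 2 ≤ d) : G = Set.univ := by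
  by_contra hne
  set u : EuclideanSpace ℝ (Fin d) := (diagonalDirection d).val
  have hcont : Continuous fun y : UnitSphere d => inner ℝ u (y : EuclideanSpace ℝ (Fin d)) := by
    fun_prop
  obtain ⟨y, hyG, hmax⟩ := hG.isClosed_compl.isCompact.exists_isMaxOn
    (Set.nonempty_compl.2 hne) hcont.continuousOn
  refine hyG (hstep y ?_)
  have hfreq : ∃ᶠ z in 𝓝 y, inner ℝ u (y : EuclideanSpace ℝ (Fin d)) <
      inner ℝ u ((z : UnitSphere d) : EuclideanSpace ℝ (Fin d)) := by
    have hyu : y ≠ diagonalDirection d := fun h => hyG (h ▸ hu)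
    refine frequently_iff.2 fun {N} hN => ?_
    by_cases hy : (y : EuclideanSpace ℝ (Fin d)) = -u
    -- At the antipode each other point is higher, and the connected sphere has no isolated points.
    · have := connectedSpace_unitSphere hd
      have : Nontrivial (UnitSphere d) := ⟨y, _, hyu⟩
      obtain ⟨z, hzN, hz⟩ := Filter.nonempty_of_mem
        (inter_mem (mem_nhdsWithin_of_mem_nhds hN) (self_mem_nhdsWithin (a := y) (s := {y}ᶜ)))
      refine ⟨z, hzN, ?_⟩
      have hnu : ‖u‖ = 1 := (diagonalDirection d).norm_coe
      have h1 := (inner_lt_one_iff_real_of_norm_eq_one hnu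
        (by rw [norm_neg, z.norm_coe] : ‖-(z : EuclideanSpace ℝ (Fin d))‖ = 1)).2
        fun h => hz (Subtype.ext (by rw [hy, h, neg_neg]))
      rw [hy, inner_neg_right, real_inner_self_eq_norm_sq, hnu]
      rw [inner_neg_right] at h1
      linarith
    · obtain ⟨z, hzN, hlt, -⟩ := exists_inner_lt_inner hyu hy hN
      exact ⟨z, hzN, hlt⟩
  refine hfreq.mono fun z hz => ?_
  by_contra hzG
  exact absurd (hmax hzG) (not_le.2 (hz.trans_le (inner_le_inner_direction_activate hα z)))

/-- The analogue of `eq_univ_of_pos` for `α < 0`, in any dimension. The activation fixes the nonnegative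
orthant, where the maximization takes place, and maps the whole sphere into it. -/
theorem eq_univ_of_neg (hα : α < 0) : G = Set.univ := by
  set u : EuclideanSpace ℝ (Fin d) := (diagonalDirection d).val
  set P : Set (UnitSphere d) := {y | ∀ i, 0 ≤ (y : EuclideanSpace ℝ (Fin d)) i} with hP
  have hPc : IsClosed P := by
    rw [hP, Set.ofPred_forall]
    refine isClosed_iInter fun i => isClosed_le continuous_const ?_
    exact (EuclideanSpace.proj (𝕜 := ℝ) i).continuous.comp continuous_subtype_val
  have hPG : P ⊆ G := by
    by_contra hne
    obtain ⟨y₀, hy₀, hy₀G⟩ := Set.not_subset.1 hne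
    have hcont : Continuous fun y : UnitSphere d => inner ℝ u (y : EuclideanSpace ℝ (Fin d)) := by
      fun_prop
    obtain ⟨y, ⟨hyG, hyP⟩, hmax⟩ := (hG.isClosed_compl.inter hPc).isCompact.exists_isMaxOn
      ⟨y₀, hy₀G, hy₀⟩ hcont.continuousOn
    have hyu : y ≠ diagonalDirection d := fun h => hyG (h ▸ hu)
    have hyu' : (y : EuclideanSpace ℝ (Fin d)) ≠ -u := by
      intro h
      have h1 := hyP 0
      rw [h] at h1
      have h2 : (-u) 0 = -(Real.sqrt d)⁻¹ := rfl
      have := inv_sqrt_pos (d := d)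
      rw [h2] at h1
      linarith
    refine hyG (hstep y (frequently_iff.2 fun {N} hN => ?_))
    obtain ⟨z, hzN, hlt, p, q, hp, hq, hz⟩ := exists_inner_lt_inner hyu hyu' hN
    have hzP : z ∈ P := by
      intro i
      rw [hz]
      exact add_nonneg (mul_nonneg hp (hyP i)) (mul_nonneg hq inv_sqrt_pos.le)
    refine ⟨z, hzN, ?_⟩
    rw [activate_of_nonneg hα hzP, direction_coe]
    by_contra hzG
    exact absurd (hmax ⟨hzG, hzP⟩) (not_le.2 hlt)
  refine Set.eq_univ_of_forall fun y => hstep y (frequently_iff.2 fun {N} hN => ?_)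
  refine ⟨y, mem_of_mem_nhds hN, hPG fun i => ?_⟩
  rw [coe_direction (activate_ne_zero hα.ne y.coe_ne_zero)]
  exact mul_nonneg (inv_nonneg.2 (norm_nonneg _)) (activate_nonneg hα _ i)

end geometry

theorem eq_or_eq_neg_of_unitSphere_one (y : UnitSphere 1) :
    y = diagonalDirection 1 ∨ (y : EuclideanSpace ℝ (Fin 1)) = -diagonalDirection 1 := by
  have h : (y : EuclideanSpace ℝ (Fin 1)) 0 ^ 2 = 1 := by
    have := norm_sq_eq_sum (y : EuclideanSpace ℝ (Fin 1))
    rw [y.norm_coe, Fin.sum_univ_one] at this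
    linarith
  rcases (sq_eq_sq_iff_eq_or_eq_neg.1 (h.trans (one_pow 2).symm)) with h | h
  · left
    refine Subtype.ext ?_
    ext i
    rw [Subsingleton.elim i 0, h, diagonalDirection_apply]
    simp
  · right
    ext i
    rw [Subsingleton.elim i 0, h]
    simp [diagonalDirection_apply]

/-! ### Poisson equation for the logarithmic growth -/

section logGrowth

variable {d : ℕ} {μ : Measure (Matrix (Fin d) (Fin d) ℝ)} {α : ℝ}

/-- The increment of `log |X_ℓ|` in one layer, for an input of direction `y`. -/
def logGrowth (α : ℝ) (W : Matrix (Fin d) (Fin d) ℝ) (y : UnitSphere d) : ℝ :=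
  Real.log ‖layer α W y‖

theorem measurable_logGrowth (α : ℝ) :
    Measurable fun p : Matrix (Fin d) (Fin d) ℝ × UnitSphere d => logGrowth α p.1 p.2 :=
  (measurable_layer.comp (measurable_fst.prodMk
    (measurable_subtype_coe.comp measurable_snd))).norm.log

theorem measurable_logGrowth_left (α : ℝ) (y : UnitSphere d) :
    Measurable fun W : Matrix (Fin d) (Fin d) ℝ => logGrowth α W y :=
  (continuous_layer_left _).measurable.norm.log

theorem log_norm_activate_sq_le (hα : α ≠ 0) {x : EuclideanSpace ℝ (Fin d)} (hx : x ≠ 0) :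
    Real.log ‖activate α x‖ ^ 2 ≤ 2 * Real.log ‖x‖ ^ 2 +
      2 * (|Real.log (min 1 |α|)| + |Real.log (max 1 |α|)|) ^ 2 := by
  have hm : 0 < min 1 |α| := lt_min zero_lt_one (abs_pos.2 hα)
  have hM : 0 < max 1 |α| := zero_lt_one.trans_le (le_max_left _ _)
  have hx0 : 0 < ‖x‖ := norm_pos_iff.2 hx
  have h1 := Real.log_le_log (mul_pos hm hx0) (min_mul_norm_le_norm_activate (α := α) x)
  have h2 := Real.log_le_log (norm_pos_iff.2 (activate_ne_zero hα hx))
    (norm_activate_le_max_mul_norm (α := α) x)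
  rw [Real.log_mul hm.ne' hx0.ne'] at h1
  rw [Real.log_mul hM.ne' hx0.ne'] at h2
  set L := |Real.log (min 1 |α|)| + |Real.log (max 1 |α|)|
  have h3 : |Real.log ‖activate α x‖ - Real.log ‖x‖| ≤ L := by
    have := neg_abs_le (Real.log (min 1 |α|))
    have := le_abs_self (Real.log (max 1 |α|))
    have := abs_nonneg (Real.log (min 1 |α|))
    have := abs_nonneg (Real.log (max 1 |α|))
    exact abs_le.2 ⟨by linarith, by linarith⟩
  have h4 := sq_le_sq' (abs_le.1 h3).1 (abs_le.1 h3).2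
  nlinarith [sq_nonneg (2 * Real.log ‖x‖ - Real.log ‖activate α x‖)]

theorem HasLogMoment.ae_layer_ne_zero (hμ : HasLogMoment μ) (hα : α ≠ 0) (y : UnitSphere d) :
    ∀ᵐ W ∂μ, layer α W (y : EuclideanSpace ℝ (Fin d)) ≠ 0 := by
  obtain ⟨C, -, h⟩ := hμ
  filter_upwards [(h y y.norm_coe).1] with W hW
  exact activate_ne_zero hα hW

theorem HasLogMoment.exists_lintegral_logGrowth_sq_le [IsProbabilityMeasure μ]
    (hμ : HasLogMoment μ) (hα : α ≠ 0) :
    ∃ C : ℝ, 0 ≤ C ∧ ∀ y : UnitSphere d,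
      ∫⁻ W, ENNReal.ofReal (logGrowth α W y ^ 2) ∂μ ≤ ENNReal.ofReal C := by
  obtain ⟨C, hC, h⟩ := hμ
  set L := 2 * (|Real.log (min 1 |α|)| + |Real.log (max 1 |α|)|) ^ 2
  have hL0 : 0 ≤ L := by positivity
  have htop : 2 * C + ENNReal.ofReal L ≠ ⊤ :=
    ENNReal.add_ne_top.2 ⟨ENNReal.mul_ne_top (by norm_num) hC, ENNReal.ofReal_ne_top⟩
  refine ⟨(2 * C + ENNReal.ofReal L).toReal, ENNReal.toReal_nonneg, fun y => ?_⟩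
  rw [ENNReal.ofReal_toReal htop]
  obtain ⟨hne, hle⟩ := h y y.norm_coe
  calc _ ≤ ∫⁻ W, (2 * ENNReal.ofReal (Real.log
          ‖WithLp.toLp 2 (W *ᵥ (y : EuclideanSpace ℝ (Fin d)).ofLp)‖ ^ 2) +
          ENNReal.ofReal L) ∂μ := by
        refine lintegral_mono_ae ?_
        filter_upwards [hne] with W hW
        refine (ENNReal.ofReal_le_ofReal (log_norm_activate_sq_le hα hW)).trans (le_of_eq ?_)
        rw [ENNReal.ofReal_add (by positivity) hL0, ENNReal.ofReal_mul zero_le_two,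
          ENNReal.ofReal_ofNat]
    _ = 2 * (∫⁻ W, ENNReal.ofReal (Real.log
          ‖WithLp.toLp 2 (W *ᵥ (y : EuclideanSpace ℝ (Fin d)).ofLp)‖ ^ 2) ∂μ) +
          ENNReal.ofReal L := by
        rw [lintegral_add_right _ measurable_const, lintegral_const_mul' _ _ (by norm_num),
          lintegral_const, measure_univ, mul_one]
    _ ≤ _ := by gcongr

theorem HasLogMoment.boundedMeasurable_integral_logGrowth [IsProbabilityMeasure μ]
    (hμ : HasLogMoment μ) (hα : α ≠ 0) :
    BoundedMeasurable fun y : UnitSphere d => ∫ W, logGrowth α W y ∂μ := by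
  obtain ⟨C, hC, h⟩ := hμ.exists_lintegral_logGrowth_sq_le hα
  have hsm : StronglyMeasurable fun y : UnitSphere d => ∫ W, logGrowth α W y ∂μ :=
    StronglyMeasurable.integral_prod_left' (μ := μ)
      (f := fun p : Matrix (Fin d) (Fin d) ℝ × UnitSphere d => logGrowth α p.1 p.2)
      (measurable_logGrowth α).stronglyMeasurable
  refine ⟨hsm.measurable, 1 + C, fun y => ?_⟩
  have hm : Measurable fun W : Matrix (Fin d) (Fin d) ℝ => logGrowth α W y :=
    measurable_logGrowth_left α y
  have hL := memLp_two_of_lintegral_sq_le hm (h y)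
  have hle := h y
  rw [← ofReal_integral_eq_lintegral_ofReal hL.integrable_sq (ae_of_all _ fun _ => sq_nonneg _),
    ENNReal.ofReal_le_ofReal_iff hC] at hle
  calc |∫ W, logGrowth α W y ∂μ| ≤ ∫ W, |logGrowth α W y| ∂μ := abs_integral_le_integral_abs
    _ ≤ ∫ W, (1 + logGrowth α W y ^ 2) ∂μ := by
        refine integral_mono (hL.integrable (by norm_num)).abs
          ((integrable_const _).add hL.integrable_sq) fun W => ?_
        change |logGrowth α W y| ≤ 1 + logGrowth α W y ^ 2
        rw [← sq_abs (logGrowth α W y)]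
        nlinarith [sq_nonneg (|logGrowth α W y| - 1), abs_nonneg (logGrowth α W y)]
    _ = 1 + ∫ W, logGrowth α W y ^ 2 ∂μ := by
        rw [integral_add (integrable_const _) hL.integrable_sq]
        simp
    _ ≤ _ := by linarith

end logGrowth

section

variable {d : ℕ} [NeZero d] {μ m : Measure (Matrix (Fin d) (Fin d) ℝ)} {η : ℝ} {c : ℝ≥0}
  {B : Set (Matrix (Fin d) (Fin d) ℝ)} {α : ℝ}

theorem isOpen_setOf_minorizedOn (μ : Measure (Matrix (Fin d) (Fin d) ℝ)) (α : ℝ)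
    (ν : Measure (UnitSphere d)) :
    IsOpen {y | ∃ V ∈ 𝓝 y, ∃ n, MinorizedOn μ (projLayer α) ν n V} := by
  refine isOpen_iff_mem_nhds.2 fun y hy => ?_
  obtain ⟨V, hV, n, h⟩ := hy
  filter_upwards [eventually_mem_nhds_iff.2 hV] with z hz
  exact ⟨V, hz, n, h⟩

/-- The set of points with a minorized neighbourhood contains `y` as soon as it contains the images of
points arbitrarily close to `y`. -/
theorem IsLocallySpread.exists_minorizedOn_nhds_of_frequently (hs : IsLocallySpread μ m η c B)
    (hα : α ≠ 0) {ν : Measure (UnitSphere d)} {y : UnitSphere d}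
    (hy : ∃ᶠ z : UnitSphere d in 𝓝 y, ∃ V ∈ 𝓝 (direction
      (activate α (z : EuclideanSpace ℝ (Fin d)))), ∃ n, MinorizedOn μ (projLayer α) ν n V) :
    ∃ V ∈ 𝓝 y, ∃ n, MinorizedOn μ (projLayer α) ν n V := by
  obtain ⟨B', -, hB', V, hV, hloc⟩ := hs.exists_lintegral_localLaw_le α y
  have hev : ∀ᶠ z in 𝓝 y, B' ∈ 𝓝 (η • sphereRotation y z) :=
    ((tendsto_sphereRotation y).const_smul η).eventually (eventually_mem_nhds_iff.2 hB')
  obtain ⟨z, ⟨U, hU, n, hmin⟩, hz⟩ := (hy.and_eventually hev).exists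
  have hU' := interior_mem_nhds.2 hU
  have hUm : MeasurableSet (interior U) := isOpen_interior.measurableSet
  refine ⟨V, hV, n + 1, (hmin.mono interior_subset).of_hitting
    (localLaw_ne_zero hs.const_ne_zero hs.measure_ne_zero hs.scale_pos hα hz hU')
    fun y' hy' => ?_⟩
  refine le_trans (le_of_eq ?_) (hloc y' hy' _ (measurable_one.indicator hUm))
  rw [lintegral_indicator_one hUm]

theorem singleton_mem_nhds_of_coe_eq_neg {y : UnitSphere 1}
    (hy : (y : EuclideanSpace ℝ (Fin 1)) = -(diagonalDirection 1).val) : {y} ∈ 𝓝 y := by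
  have hne : y ≠ diagonalDirection 1 := by
    intro h
    have h1 : (diagonalDirection 1).val = -(diagonalDirection 1).val := by
      rw [← hy, h]
    have h2 : (Real.sqrt (1 : ℕ))⁻¹ = -(Real.sqrt (1 : ℕ))⁻¹ :=
      congrArg (fun x : EuclideanSpace ℝ (Fin 1) => x 0) h1
    have := inv_sqrt_pos (d := 1)
    linarith
  filter_upwards [isOpen_ne.mem_nhds hne] with z hz
  rcases eq_or_eq_neg_of_unitSphere_one z with h | h
  · exact absurd h hz
  · exact Subtype.ext (h.trans hy.symm)

theorem projLayer_one_of_det_neg {α : ℝ} {y : UnitSphere 1}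
    (hy : (y : EuclideanSpace ℝ (Fin 1)) = -(diagonalDirection 1).val)
    {W : Matrix (Fin 1) (Fin 1) ℝ} (hW : W.det < 0) :
    projLayer α W y = diagonalDirection 1 := by
  have h : WithLp.toLp 2 (W *ᵥ (y : EuclideanSpace ℝ (Fin 1)).ofLp) =
      (-W.det) • (diagonalDirection 1).val := by
    rw [hy]
    ext i
    rw [Subsingleton.elim i 0]
    simp [Matrix.mulVec, dotProduct]
  rw [projLayer, layer_eq_activate, h, activate_smul (by linarith), direction_smul (by linarith),
    direction_activate_diagonalDirection]

/-- Doeblin's condition for the projected chain. The minorizing measure is the local law at the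
diagonal direction, which is fixed by the activation, so that this law charges the neighbourhood on
which it minorizes. -/
theorem IsLocallySpread.exists_minorizedOn_univ (hs : IsLocallySpread μ m η c B)
    [IsProbabilityMeasure μ] (hα : α ≠ 0)
    (hone : d = 1 → α < 0 ∨ 0 < μ {W | W.det < 0}) :
    ∃ (ν : Measure (UnitSphere d)) (n : ℕ), IsFiniteMeasure ν ∧ ν ≠ 0 ∧
      MinorizedOn μ (projLayer α) ν n Set.univ := by
  set u := diagonalDirection d with hu
  obtain ⟨B', hB'B, hB', V, hV, hloc⟩ := hs.exists_lintegral_localLaw_le α u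
  set ν := localLaw m c B' α u with hν
  have hUm : MeasurableSet (interior V) := isOpen_interior.measurableSet
  have hU : interior V ∈ 𝓝 u := interior_mem_nhds.2 hV
  have hU0 : ν (interior V) ≠ 0 := by
    refine localLaw_ne_zero (z := u) hs.const_ne_zero hs.measure_ne_zero hs.scale_pos hα ?_ ?_
    · rwa [sphereRotation, rotation_self (dotProduct_self_unitSphere u)]
    · rwa [hu, direction_activate_diagonalDirection]
  have hfin : IsFiniteMeasure ν := by
    have h1 : IsFiniteMeasure (m.restrict B') :=
      ⟨by
        rw [Measure.restrict_apply_univ]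
        exact (measure_mono hB'B).trans_lt hs.measure_ne_top.lt_top⟩
    rw [hν, localLaw]
    infer_instance
  have hbase : ∀ y ∈ interior V, ∀ h : UnitSphere d → ℝ≥0∞, Measurable h →
      ∫⁻ z, h z ∂ν ≤ lintegralTransfer μ (projLayer α) h y := fun y hy =>
    hloc y (interior_subset hy)
  set G : Set (UnitSphere d) := {y | ∃ V ∈ 𝓝 y, ∃ n, MinorizedOn μ (projLayer α) ν n V}
  have hGo : IsOpen G := isOpen_setOf_minorizedOn μ α ν
  have huG : u ∈ G := ⟨interior V, hU, 1, 1, one_ne_zero, fun y hy h hh => by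
    rw [one_mul]
    exact hbase y hy h hh⟩
  have hstep : ∀ y : UnitSphere d, (∃ᶠ z : UnitSphere d in 𝓝 y,
      direction (activate α (z : EuclideanSpace ℝ (Fin d))) ∈ G) → y ∈ G := fun y hy =>
    hs.exists_minorizedOn_nhds_of_frequently hα hy
  have huniv : G = Set.univ := by
    rcases lt_or_gt_of_ne hα with hneg | hpos
    · exact eq_univ_of_neg hGo huG hstep hneg
    · rcases Nat.lt_or_ge d 2 with hd | hd
      · have hd1 : d = 1 := by
          have := NeZero.ne d
          omega
        subst hd1
        have hdet := (hone rfl).resolve_left (not_lt.2 hpos.le)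
        refine Set.eq_univ_of_forall fun y => ?_
        rcases eq_or_eq_neg_of_unitSphere_one y with hy | hy
        · rw [hy]
          exact huG
        · have hmin : MinorizedOn μ (projLayer α) ν 1 (interior V) :=
            ⟨1, one_ne_zero, fun y hy h hh => by
              rw [one_mul]
              exact hbase y hy h hh⟩
          -- The antipode is an isolated point, from which `det W < 0` leads to the diagonal direction.
          refine ⟨{y}, singleton_mem_nhds_of_coe_eq_neg hy, 2, hmin.of_hitting hdet.ne' ?_⟩
          rintro _ rfl
          have hdm : MeasurableSet {W : Matrix (Fin 1) (Fin 1) ℝ | W.det < 0} :=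
            (isOpen_lt (continuous_id.matrix_det) continuous_const).measurableSet
          rw [← lintegral_indicator_one hdm, lintegralTransfer]
          refine lintegral_mono fun W => ?_
          by_cases hW : W.det < 0
          · rw [projLayer_one_of_det_neg hy hW, Set.indicator_of_mem (mem_of_mem_nhds hU)]
            exact Set.indicator_le_self _ _ _
          · rw [Set.indicator_of_notMem (by exact hW)]
            exact zero_le
      · exact eq_univ_of_pos hGo huG hstep hpos hd
  obtain ⟨n, hn⟩ := RandomIteration.exists_minorizedOn_univ (measurable_projLayer α) hUm hU0 hbase
    fun y => (huniv ▸ Set.mem_univ y : y ∈ G)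
  exact ⟨ν, n, hfin, fun h0 => hU0 (by rw [h0]; rfl), hn⟩

/-- In dimension one and for `α = 1` the increment does not depend on the direction. The projected
chain need not mix in this case. -/
theorem logGrowth_one_eq (W : Matrix (Fin 1) (Fin 1) ℝ) (y : UnitSphere 1) :
    logGrowth 1 W y = logGrowth 1 W (diagonalDirection 1) := by
  have hact : ∀ x : EuclideanSpace ℝ (Fin 1), activate 1 x = x := fun x => by
    ext i
    simp [activate, leakyReLU]
  rcases eq_or_eq_neg_of_unitSphere_one y with hy | hy
  · rw [hy]
  · rw [logGrowth, logGrowth, layer_eq_activate, layer_eq_activate, hact, hact, hy,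
      WithLp.ofLp_neg, Matrix.mulVec_neg, WithLp.toLp_neg, norm_neg]

theorem IsLocallySpread.exists_logGrowth_poisson_solution (hs : IsLocallySpread μ m η c B)
    [IsProbabilityMeasure μ] (hμ : HasLogMoment μ) (hα : α ≠ 0)
    (hone : d = 1 → α < 0 ∨ α = 1 ∨ 0 < μ {W | W.det < 0}) :
    ∃ (lam : ℝ) (g : UnitSphere d → ℝ), BoundedMeasurable g ∧
      ∀ y, ∫ W, logGrowth α W y ∂μ = lam + g y - ∫ W, g (projLayer α W y) ∂μ := by
  by_cases h1 : d = 1 ∧ α = 1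
  · obtain ⟨rfl, rfl⟩ := h1
    refine ⟨∫ W, logGrowth 1 W (diagonalDirection 1) ∂μ, fun _ => 0,
      ⟨measurable_const, 0, fun _ => by simp⟩, fun y => ?_⟩
    simp [logGrowth_one_eq _ y]
  · obtain ⟨ν, n, hfin, hν, hmin⟩ := hs.exists_minorizedOn_univ hα fun hd => by
      rcases hone hd with h | h | h
      · exact Or.inl h
      · exact absurd ⟨hd, h⟩ h1
      · exact Or.inr h
    exact exists_poisson_solution_of_minorizedOn_univ (measurable_projLayer α) hν hmin
      (hμ.boundedMeasurable_integral_logGrowth hα)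

end

/-! ### From the projected chain to the activations -/

section

variable {d : ℕ} [NeZero d] {α : ℝ} {x₀ : EuclideanSpace ℝ (Fin d)}
  {ω : ℕ → Matrix (Fin d) (Fin d) ℝ}

/-- As long as the projected chain never meets a vanishing layer output, it is the direction of the
activations, and the logarithm of their norm is the sum of the increments along it. -/
theorem activation_eq_of_orbit (hx₀ : x₀ ≠ 0)
    (hω : ∀ n, layer α (ω n) (orbit (projLayer α) (direction x₀) ω n).val ≠ 0) (n : ℕ) :
    activation α x₀ ω n ≠ 0 ∧
      direction (activation α x₀ ω n) = orbit (projLayer α) (direction x₀) ω n ∧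
      Real.log ‖activation α x₀ ω n‖ = Real.log ‖x₀‖ +
        cocycleSum (projLayer α) (logGrowth α) 0 n (direction x₀) ω := by
  induction n with
  | zero => exact ⟨hx₀, rfl, by simp [cocycleSum, activation]⟩
  | succ n ih =>
    obtain ⟨h0, hdir, hlog⟩ := ih
    have hpos : 0 < ‖activation α x₀ ω n‖ := norm_pos_iff.2 h0
    have hstep : activation α x₀ ω (n + 1) = ‖activation α x₀ ω n‖ •
        layer α (ω n) (orbit (projLayer α) (direction x₀) ω n).val := by
      rw [← hdir, ← layer_smul hpos.le, norm_smul_direction h0]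
      rfl
    refine ⟨?_, ?_, ?_⟩
    · rw [hstep]
      exact smul_ne_zero hpos.ne' (hω n)
    · rw [hstep, direction_smul hpos]
      rfl
    · rw [hstep, norm_smul, norm_norm, Real.log_mul hpos.ne' (norm_ne_zero_iff.2 (hω n)), hlog]
      simp only [cocycleSum, zero_add]
      rw [Finset.sum_range_succ, add_assoc]
      rfl

end

theorem HasLogMoment.ae_activation {d : ℕ} [NeZero d]
    {μ : Measure (Matrix (Fin d) (Fin d) ℝ)} [IsProbabilityMeasure μ] (hμ : HasLogMoment μ)
    {α : ℝ} (hα : α ≠ 0) {x₀ : EuclideanSpace ℝ (Fin d)} (hx₀ : x₀ ≠ 0) :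
    ∀ᵐ ω ∂(Measure.infinitePi fun _ : ℕ => μ), ∀ n, activation α x₀ ω n ≠ 0 ∧
      Real.log ‖activation α x₀ ω n‖ = Real.log ‖x₀‖ +
        cocycleSum (projLayer α) (logGrowth α) 0 n (direction x₀) ω := by
  have hm : MeasurableSet {q : Matrix (Fin d) (Fin d) ℝ × UnitSphere d |
      layer α q.1 (q.2 : EuclideanSpace ℝ (Fin d)) ≠ 0} :=
    (measurable_layer.comp (measurable_fst.prodMk (measurable_subtype_coe.comp measurable_snd)))
      (measurableSet_singleton 0).compl
  filter_upwards [ae_forall_orbit (measurable_projLayer α) hm (hμ.ae_layer_ne_zero hα)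
    (direction x₀)] with ω hω n
  obtain ⟨h0, -, hlog⟩ := activation_eq_of_orbit hx₀ hω n
  exact ⟨h0, hlog⟩

end LeakyReLUNet

end

theorem theorem2p2 (d : ℕ) (hd : 1 ≤ d)
    (μ : Measure (Matrix (Fin d) (Fin d) ℝ)) [IsProbabilityMeasure μ]
    (hμ : (∃ p, LeakyReLUNet.HasIndependentEntryDensities μ p) ∨
      (∃ η p, LeakyReLUNet.HasScaledOrthogonalDensity μ η p))
    (α : ℝ) (hα : α ≠ 0)
    (hone : d = 1 → α < 0 ∨ α = 1 ∨ 0 < μ {W | W.det < 0}) :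
    ∃ lam : ℝ,
      (∀ x₀ : EuclideanSpace ℝ (Fin d), x₀ ≠ 0 →
        ∀ᵐ ω ∂(Measure.infinitePi fun _ : ℕ => μ),
          (∀ ℓ, LeakyReLUNet.activation α x₀ ω ℓ ≠ 0) ∧
          Tendsto (fun ℓ : ℕ => 1 / (ℓ : ℝ) * Real.log ‖LeakyReLUNet.activation α x₀ ω ℓ‖)
            atTop (𝓝 lam)) ∧
      Tendsto
        (fun ℓ : ℕ => ⨆ (x₀ : EuclideanSpace ℝ (Fin d)) (_ : x₀ ≠ 0),
          ∫⁻ ω, ENNReal.ofReal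
            |1 / (ℓ : ℝ) * Real.log (‖LeakyReLUNet.activation α x₀ ω ℓ‖ / ‖x₀‖) - lam|
            ∂(Measure.infinitePi fun _ : ℕ => μ))
        atTop (𝓝 (0 : ℝ≥0∞)) := by
  have hd0 : NeZero d := ⟨by omega⟩
  have hmom : LeakyReLUNet.HasLogMoment μ := by
    rcases hμ with ⟨p, h⟩ | ⟨η, p, h⟩
    · exact h.hasLogMoment hd
    · exact h.hasLogMoment
  obtain ⟨m, η, c, B, hs⟩ : ∃ m η c B, LeakyReLUNet.IsLocallySpread μ m η c B := by
    rcases hμ with ⟨p, h⟩ | ⟨η, p, h⟩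
    · exact h.exists_isLocallySpread
    · exact h.exists_isLocallySpread
  obtain ⟨lam, g, ⟨hg, b, hb⟩, hP⟩ := hs.exists_logGrowth_poisson_solution hmom hα hone
  obtain ⟨C, hC, hF2⟩ := hmom.exists_lintegral_logGrowth_sq_le hα
  have hΨ := LeakyReLUNet.measurable_projLayer (d := d) α
  have hF := LeakyReLUNet.measurable_logGrowth (d := d) α
  refine ⟨lam, fun x₀ hx₀ => ?_, ?_⟩
  · filter_upwards [hmom.ae_activation hα hx₀,
      RandomIteration.ae_tendsto_of_poisson hΨ hF hC hF2 hg hb hP (LeakyReLUNet.direction x₀)] with ω hω hlim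
    refine ⟨fun ℓ => (hω ℓ).1, ?_⟩
    have h1 := (tendsto_const_div_atTop_nhds_zero_nat (Real.log ‖x₀‖)).add hlim
    rw [zero_add] at h1
    refine h1.congr fun ℓ => ?_
    rw [(hω ℓ).2]
    ring
  · obtain ⟨K, hK⟩ := RandomIteration.exists_lintegral_abs_le_of_poisson hΨ hF hC hF2 hg hb hP
    have h1 : Tendsto (fun ℓ : ℕ => ENNReal.ofReal (K / Real.sqrt ℓ)) atTop (𝓝 0) := by
      have h2 : Tendsto (fun ℓ : ℕ => K / Real.sqrt ℓ) atTop (𝓝 0) :=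
        tendsto_const_nhds.div_atTop (Real.tendsto_sqrt_atTop.comp tendsto_natCast_atTop_atTop)
      simpa using ENNReal.tendsto_ofReal h2
    refine tendsto_of_tendsto_of_tendsto_of_le_of_le' tendsto_const_nhds h1
      (Eventually.of_forall fun _ => zero_le) ?_
    filter_upwards [eventually_ge_atTop 1] with ℓ hℓ
    refine iSup₂_le fun x₀ hx₀ => le_trans (le_of_eq ?_) (hK ℓ hℓ (LeakyReLUNet.direction x₀))
    refine lintegral_congr_ae ?_
    filter_upwards [hmom.ae_activation hα hx₀] with ω hω
    rw [Real.log_div (norm_ne_zero_iff.2 (hω ℓ).1) (norm_ne_zero_iff.2 hx₀), (hω ℓ).2,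
      add_sub_cancel_left, one_div_mul_eq_div]
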